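/- Let $a<b$, $\mathcal X=[a,b]$, $c\in(a,b)$, $M>0$, and let $\mathcal F$ be one of the three classes of functions $f$ on $[a,b]$ with $0\le f(x)\le M$ for all $x\in[a,b]$: (Monotonicity) those that are non-increasing on $[a,b]$; (Convexity) those that are convex on $[a,b]$; (Unimodality) those that are non-decreasing on $[a,c]$ and non-increasing on $[c,b]$. Let $g$ be a probability density on $[a,b]$ with $\inf_{x\in[a,b]}g(x)>0$, let $X_1,X_2,\dots$ be i.i.d. with density $g$ on a probability space $(\Omega,\mathcal G,\mathbb P)$, and let $\mathcal L=\{f/g: f\in\mathcal F\}$. Let $0\le m\le l$, let $\phi_0,\dots,\phi_l:[a,b]\to\mathbb R$ be measurable with $\int_a^b|\phi_j(x)|^{2+\delta}dx<\infty$ for all $j=0,\dots,l$ and some $\delta>0$, and let $\mu_1,\dots,\mu_l\in\mathbb R$. Consider $$(\mathcal P):\ \sup_{L\in\mathcal L}\ \mathbb E_g[\phi_0(X)L(X)]\ \text{ s.t. }\ \mathbb E_g[\phi_j(X)L(X)]\le\mu_j\ (1\le j\le m),\quad \mathbb E_g[\phi_j(X)L(X)]=\mu_j\ (m<j\le l),$$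 and, for $n\ge1$, its importance-weighted sample average approximation (IW-SAA) $$(\mathcal P_n):\ \sup_{L\in\mathcal L}\ \frac1n\sum_{i=1}^n\phi_0(X_i)L(X_i)\ \text{ s.t. }\ \frac1n\sum_{i=1}^n\phi_j(X_i)L(X_i)\le\mu_j\ (1\le j\le m),\quad \frac1n\sum_{i=1}^n\phi_j(X_i)L(X_i)=\mu_j\ (m<j\le l).$$ Write $val(\cdot)\in[-\infty,\infty]$ for the optimal value, with $\sup\emptyset=-\infty$. Assume that there is $L_0\in\mathcal L$ with $\mathbb E_g[\phi_jL_0]<\mu_j$ for $1\le j\le m$ and $\mathbb E_g[\phi_jL_0]=\mu_j$ for $m<j\le l$, and that $(\mu_{m+1},\dots,\mu_l)$ is an interior point of $\{(\mathbb E_g[\phi_{m+1}L],\dots,\mathbb E_g[\phi_lL]):L\in\mathcal L\}\subset\mathbb R^{l-m}$. Let $X_{(1)}\le\dots\le X_{(n)}$ be the order statistics of $X_1,\dots,X_n$, and put $X_{(0)}=a$, $X_{(n+1)}=b$. Let $(\mathcal P_n')$ be the linear program with the same objective and the same moment constraints as $(\mathcal P_n)$, in which the decision variables are the numbers $L(X_1),\dots,L(X_n)$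 (and, in the convex case, also $L(X_{(0)})$ and $L(X_{(n+1)})$), and in which $L\in\mathcal L$ is replaced by the discrete shape constraint, where $V_i:=L(X_{(i)})g(X_{(i)})$: - (Monotonicity) $V_{i+1}\le V_i$ for $1\le i\le n-1$, and $0\le L(X_i)g(X_i)\le M$ for $1\le i\le n$; - (Convexity) $\dfrac{V_{i+1}-V_i}{X_{(i+1)}-X_{(i)}}\le\dfrac{V_{i+2}-V_{i+1}}{X_{(i+2)}-X_{(i+1)}}$ for $0\le i\le n-1$, and $0\le V_i\le M$ for $0\le i\le n+1$; - (Unimodality) for $1\le i\le n$: $V_{i-1}\le V_i$ if $X_{(i)}\le c$, and $V_{i+1}\le V_i$ if $X_{(i)}\ge c$ (with the convention $V_0=V_{n+1}=0$), and $0\le L(X_i)g(X_i)\le M$. Then: 1. Almost surely, for every $n\ge1$, $(\mathcal P_n)$ is equivalent to $(\mathcal P_n')$: the map sending $L$ to its values at the points that carry the decision variables maps $\mathcal L$ onto the set given by the discrete shape constraint and the feasible set of $(\mathcal P_n)$ onto the feasible set of $(\mathcal P_n')$, so that, the objective depending only on these values, $val(\mathcal P_n)=val(\mathcal P_n')$.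 2. $val(\mathcal P)$ is finite and $|val(\mathcal P_n)-val(\mathcal P)|\to0$ outer almost surely, i.e. the minimal measurable majorants of $|val(\mathcal P_n)-val(\mathcal P)|$ converge to $0$ almost surely. 3. $\sqrt n\,(val(\mathcal P_n)-val(\mathcal P))=O_{\mathbb P^*}(1)$, i.e. for every $\varepsilon>0$ there is $K>0$ with $\limsup_{n\to\infty}\mathbb P^*\big(|\sqrt n\,(val(\mathcal P_n)-val(\mathcal P))|\ge K\big)\le\varepsilon$, where $\mathbb P^*$ is outer probability. -/

import Mathlib

open MeasureTheory ProbabilityTheory Set Filter Topology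
open scoped ENNReal

namespace IWSAA

noncomputable section

/-! ### Outer stochastic convergence -/

/-- `U` is a minimal measurable majorant of the (arbitrary) map `T`. -/
def IsMinMeasMajorant {Ω : Type*} [MeasurableSpace Ω] (P : Measure Ω) (T U : Ω → ℝ≥0∞) : Prop :=
  Measurable U ∧ (∀ ω, T ω ≤ U ω) ∧
    ∀ V : Ω → ℝ≥0∞, Measurable V → (∀ᵐ ω ∂P, T ω ≤ V ω) → ∀ᵐ ω ∂P, U ω ≤ V ω

/-- `Y n → Z` outer almost surely: the minimal measurable majorants of the distances
`|Y n - Z|` tend to zero almost surely. -/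
def TendstoOuterAS {Ω : Type*} [MeasurableSpace Ω] (P : Measure Ω)
    (Y : ℕ → Ω → EReal) (Z : Ω → EReal) : Prop :=
  ∃ U : ℕ → Ω → ℝ≥0∞,
    (∀ n, IsMinMeasMajorant P (fun ω => (Y n ω - Z ω).abs) (U n)) ∧
      ∀ᵐ ω ∂P, Tendsto (fun n => U n ω) atTop (𝓝 0)

/-- `Y n = O(1)` in outer probability. A Mathlib measure of a non-measurable set is its outer
measure, so `P {ω | …}` is the outer probability. -/
def IsBigOOneOuter {Ω : Type*} [MeasurableSpace Ω] (P : Measure Ω) (Y : ℕ → Ω → EReal) : Prop :=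
  ∀ ε : ℝ, 0 < ε → ∃ K : ℝ, 0 < K ∧
    limsup (fun n => P {ω | ENNReal.ofReal K ≤ (Y n ω).abs}) atTop ≤ ENNReal.ofReal ε

/-! ### Shape constraints on `[a, b]` -/

/-- The three one-dimensional shapes. -/
inductive Shape
  | monotonicity
  | convexity
  | unimodality

/-- The shape itself, for a function on `[a, b]` (with mode `c` for unimodality). -/
def Shape.Holds (a b c : ℝ) : Shape → (ℝ → ℝ) → Prop
  | .monotonicity, f => AntitoneOn f (Icc a b)
  | .convexity, f => ConvexOn ℝ (Icc a b) f
  | .unimodality, f => MonotoneOn f (Icc a c) ∧ AntitoneOn f (Icc c b)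

/-- The class `𝓕`: functions on `[a, b]` with values in `[0, M]` and the given shape. Functions on
`[a, b]` are represented by functions on `ℝ`, whose values outside `[a, b]` play no role. -/
def shapeClass (a b c M : ℝ) (s : Shape) : Set (ℝ → ℝ) :=
  {f | (∀ x ∈ Icc a b, 0 ≤ f x ∧ f x ≤ M) ∧ s.Holds a b c f}

/-- The class `𝓛 = {f / g : f ∈ 𝓕}` of likelihood ratios. -/
def ratioClass (a b c M : ℝ) (g : ℝ → ℝ) (s : Shape) : Set (ℝ → ℝ) :=
  {L | ∃ f ∈ shapeClass a b c M s, L = fun x => f x / g x}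

/-! ### The optimization problem and its sample average approximation -/

/-- The law on `[a, b]` with density `g`. -/
def samplingLaw (a b : ℝ) (g : ℝ → ℝ) : Measure ℝ :=
  (volume.restrict (Icc a b)).withDensity (fun x => ENNReal.ofReal (g x))

/-- `E_g[h(X)]`. -/
def expect (a b : ℝ) (g : ℝ → ℝ) (h : ℝ → ℝ) : ℝ := ∫ x, h x ∂(samplingLaw a b g)

/-- The sample average `(1/n) ∑ h(xᵢ)`. -/
def sampleMean {n : ℕ} (x : Fin n → ℝ) (h : ℝ → ℝ) : ℝ := (1 / (n : ℝ)) * ∑ i, h (x i)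

/-- The feasible set for the mean functional `E`: the constraints indexed by `Fin m` are
inequalities, those indexed by `Fin q` are equalities. -/
def feasible {m q : ℕ} (E : (ℝ → ℝ) → ℝ) (C : Set (ℝ → ℝ))
    (φ : Fin m ⊕ Fin q → ℝ → ℝ) (μ : Fin m ⊕ Fin q → ℝ) : Set (ℝ → ℝ) :=
  {L | (∀ j : Fin m, E (fun x => φ (.inl j) x * L x) ≤ μ (.inl j)) ∧
    (∀ j : Fin q, E (fun x => φ (.inr j) x * L x) = μ (.inr j)) ∧ L ∈ C}

/-- The optimal value, with `sup ∅ = -∞`. -/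
def value {m q : ℕ} (E : (ℝ → ℝ) → ℝ) (C : Set (ℝ → ℝ)) (φ₀ : ℝ → ℝ)
    (φ : Fin m ⊕ Fin q → ℝ → ℝ) (μ : Fin m ⊕ Fin q → ℝ) : EReal :=
  ⨆ L ∈ feasible E C φ μ, ((E (fun x => φ₀ x * L x) : ℝ) : EReal)

/-- The Slater condition: a strictly feasible `L₀`, and the vector of right-hand sides of the
equality constraints is interior to the set of attainable moment vectors. -/
def SlaterCondition {m q : ℕ} (E : (ℝ → ℝ) → ℝ) (C : Set (ℝ → ℝ))
    (φ : Fin m ⊕ Fin q → ℝ → ℝ) (μ : Fin m ⊕ Fin q → ℝ) : Prop :=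
  (∃ L₀ ∈ C, (∀ j : Fin m, E (fun x => φ (.inl j) x * L₀ x) < μ (.inl j)) ∧
    ∀ j : Fin q, E (fun x => φ (.inr j) x * L₀ x) = μ (.inr j)) ∧
  (fun j : Fin q => μ (.inr j)) ∈
    interior {v : Fin q → ℝ | ∃ L ∈ C, v = fun j => E (fun x => φ (.inr j) x * L x)}

/-! ### The linear program -/

/-- `u` read with indices `1, …, n`, with value `lo` at `0` and `hi` above `n`. -/
def padded {n : ℕ} (lo hi : ℝ) (u : Fin n → ℝ) (i : ℕ) : ℝ :=
  if h : 1 ≤ i ∧ i ≤ n then u ⟨i - 1, by omega⟩ else if i = 0 then lo else hi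

/-- The order statistics `X_(1) ≤ ⋯ ≤ X_(n)`, with `X_(0) = a` and `X_(n+1) = b`. -/
def orderStat {n : ℕ} (a b : ℝ) (x : Fin n → ℝ) (i : ℕ) : ℝ :=
  padded a b (fun k => x (Tuple.sort x k)) i

/-- The numbers `L(X_(i)) g(X_(i))`, where `v k = L(X_k)`, with value `lo` at `i = 0` and `hi` at
`i = n + 1`. -/
def orderVal {n : ℕ} (g : ℝ → ℝ) (x v : Fin n → ℝ) (lo hi : ℝ) (i : ℕ) : ℝ :=
  padded lo hi (fun k => v (Tuple.sort x k) * g (x (Tuple.sort x k))) i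

/-- The decision variables besides `L(X_1), …, L(X_n)`: the two end values `L(X_(0)) = L(a)` and
`L(X_(n+1)) = L(b)` in the convex case, none in the other cases. -/
@[reducible] def Shape.Ends : Shape → Type
  | .monotonicity => Unit
  | .convexity => ℝ × ℝ
  | .unimodality => Unit

/-- The end values of a function `L`. -/
def Shape.ends (a b : ℝ) (L : ℝ → ℝ) : (s : Shape) → s.Ends
  | .monotonicity => ()
  | .convexity => (L a, L b)
  | .unimodality => ()

/-- The values of `L` that are the decision variables of the linear program. -/
def evalAt {n : ℕ} (a b : ℝ) (s : Shape) (x : Fin n → ℝ) (L : ℝ → ℝ) : (Fin n → ℝ) × s.Ends :=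
  (fun i => L (x i), s.ends a b L)

/-- The discrete shape constraint: linear inequalities in the decision variables. -/
def discreteShape {n : ℕ} (a b c M : ℝ) (g : ℝ → ℝ) (x : Fin n → ℝ) :
    (s : Shape) → Set ((Fin n → ℝ) × s.Ends)
  | .monotonicity => {p |
      (∀ i : ℕ, 1 ≤ i → i + 1 ≤ n → orderVal g x p.1 0 0 (i + 1) ≤ orderVal g x p.1 0 0 i) ∧
      ∀ i, 0 ≤ p.1 i * g (x i) ∧ p.1 i * g (x i) ≤ M}
  | .convexity => {p |
      let X := orderStat a b x
      let V := orderVal g x p.1 (p.2.1 * g a) (p.2.2 * g b)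
      (∀ i : ℕ, i + 1 ≤ n →
        (V (i + 1) - V i) / (X (i + 1) - X i) ≤
          (V (i + 2) - V (i + 1)) / (X (i + 2) - X (i + 1))) ∧
      ∀ i : ℕ, i ≤ n + 1 → 0 ≤ V i ∧ V i ≤ M}
  | .unimodality => {p |
      -- here `L(X_(0)) = L(X_(n+1)) = 0` by convention
      let X := orderStat a b x
      let V := orderVal g x p.1 0 0
      (∀ i : ℕ, 1 ≤ i → i ≤ n →
        (X i ≤ c → V (i - 1) ≤ V i) ∧ (c ≤ X i → V (i + 1) ≤ V i)) ∧
      ∀ i, 0 ≤ p.1 i * g (x i) ∧ p.1 i * g (x i) ≤ M}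

/-- The feasible set of the linear program. -/
def lpFeasible {m q n : ℕ} (a b c M : ℝ) (g : ℝ → ℝ) (s : Shape)
    (φ : Fin m ⊕ Fin q → ℝ → ℝ) (μ : Fin m ⊕ Fin q → ℝ) (x : Fin n → ℝ) :
    Set ((Fin n → ℝ) × s.Ends) :=
  {p | (∀ j : Fin m, (1 / (n : ℝ)) * ∑ i, φ (.inl j) (x i) * p.1 i ≤ μ (.inl j)) ∧
    (∀ j : Fin q, (1 / (n : ℝ)) * ∑ i, φ (.inr j) (x i) * p.1 i = μ (.inr j)) ∧
    p ∈ discreteShape a b c M g x s}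

/-- The optimal value of the linear program. -/
def lpValue {m q n : ℕ} (a b c M : ℝ) (g : ℝ → ℝ) (s : Shape) (φ₀ : ℝ → ℝ)
    (φ : Fin m ⊕ Fin q → ℝ → ℝ) (μ : Fin m ⊕ Fin q → ℝ) (x : Fin n → ℝ) : EReal :=
  ⨆ p ∈ lpFeasible a b c M g s φ μ x, (((1 / (n : ℝ)) * ∑ i, φ₀ (x i) * p.1 i : ℝ) : EReal)

end

end IWSAA

open IWSAA

/-! ### Minimal measurable majorants -/

theorem exists_isMinMeasMajorant {Ω : Type*} [MeasurableSpace Ω] (P : Measure Ω)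
    [IsFiniteMeasure P] (T : Ω → ℝ≥0∞) : ∃ U, IsMinMeasMajorant P T U := by
  classical
  let H : ℚ → Set Ω := fun r => toMeasurable P {ω | ENNReal.ofReal r < T ω}
  refine ⟨fun ω => ⨆ r : ℚ, (H r).indicator (fun _ => ENNReal.ofReal r) ω, ?_, ?_, ?_⟩
  · exact Measurable.iSup fun r => measurable_const.indicator (measurableSet_toMeasurable _ _)
  · intro ω
    refine le_of_forall_lt fun t ht => ?_
    obtain ⟨r, hr0, htr, hrT⟩ := ENNReal.lt_iff_exists_rat_btwn.1 ht
    refine htr.trans_le ?_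
    refine le_iSup_of_le r ?_
    have : ω ∈ H r := subset_toMeasurable P _ hrT
    rw [indicator_of_mem this]
    exact le_rfl
  · intro V hV hTV
    have key : ∀ r : ℚ, ∀ᵐ ω ∂P, ω ∈ H r → ENNReal.ofReal r ≤ V ω := by
      intro r
      have h0 : P (H r ∩ {ω | V ω < ENNReal.ofReal r}) = 0 := by
        have hm : MeasurableSet {ω | V ω < ENNReal.ofReal r} :=
          measurableSet_lt hV measurable_const
        rw [Measure.measure_toMeasurable_inter_of_sFinite hm]
        refine measure_mono_null ?_ (ae_iff.1 hTV)
        rintro ω ⟨h1, h2⟩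
        simp only [mem_ofPred_eq, not_le] at *
        exact h2.trans h1
      have := measure_eq_zero_iff_ae_notMem.1 h0
      filter_upwards [this] with ω hω hmem
      by_contra hlt
      exact hω ⟨hmem, not_le.1 hlt⟩
    filter_upwards [ae_all_iff.2 key] with ω hω
    refine iSup_le fun r => ?_
    by_cases hm : ω ∈ H r
    · rw [indicator_of_mem hm]; exact hω r hm
    · rw [indicator_of_notMem hm]; exact zero_le

theorem ae_le_of_isMinMeasMajorant {Ω : Type*} [MeasurableSpace Ω] {P : Measure Ω}
    {T U : Ω → ℝ≥0∞} (h : IsMinMeasMajorant P T U) {V : Ω → ℝ≥0∞} (hV : AEMeasurable V P)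
    (hTV : ∀ᵐ ω ∂P, T ω ≤ V ω) : ∀ᵐ ω ∂P, U ω ≤ V ω := by
  have := h.2.2 (hV.mk V) hV.measurable_mk
    (by filter_upwards [hTV, hV.ae_eq_mk] with ω h1 h2 using h2 ▸ h1)
  filter_upwards [this, hV.ae_eq_mk] with ω h1 h2 using h2 ▸ h1

/-! ### Random signs -/

/-- The sign attached to a Boolean. -/
def boolSign (b : Bool) : ℝ := if b then 1 else -1

theorem boolSign_not (b : Bool) : boolSign (!b) = -boolSign b := by cases b <;> simp [boolSign]

theorem boolSign_sq (b : Bool) : boolSign b ^ 2 = 1 := by cases b <;> simp [boolSign]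

/-- Trajectorial form of Doob's `L²` maximal inequality for signed sums along an ordering. -/
theorem exists_prefix_bound_aux {n : ℕ} (x y : Fin n → ℝ) (s : Finset (Fin n)) :
    ∃ B : (Fin n → Bool) → ℝ,
      (∀ ε q, |∑ i ∈ s, (if x i ≤ q then boolSign (ε i) * y i else 0)| ≤ B ε) ∧
      (∀ ε, ∀ a ∉ s, ∀ b, B (Function.update ε a b) = B ε) ∧
      ∑ ε, (4 * (∑ i ∈ s, boolSign (ε i) * y i) ^ 2
        - 4 * B ε * |∑ i ∈ s, boolSign (ε i) * y i| + 2 * B ε ^ 2)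
        ≤ ∑ _ε : Fin n → Bool, 4 * ∑ i ∈ s, y i ^ 2 := by
  classical
  induction s using Finset.induction_on_max_value x with
  | empty => exact ⟨fun _ => 0, by simp, by simp, by simp⟩
  | insert a s ha hmax ih =>
    obtain ⟨B, hB, hupd, hsum⟩ := ih
    have hB0 : ∀ ε, 0 ≤ B ε := fun ε => (abs_nonneg _).trans (hB ε 0)
    set S : (Fin n → Bool) → ℝ := fun ε => ∑ i ∈ s, boolSign (ε i) * y i with hS
    refine ⟨fun ε => max (B ε) |boolSign (ε a) * y a + S ε|, ?_, ?_, ?_⟩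
    · intro ε q
      rw [Finset.sum_insert ha]
      by_cases hq : x a ≤ q
      · refine le_max_of_le_right (le_of_eq ?_)
        rw [if_pos hq]
        congr 2
        refine Finset.sum_congr rfl fun i hi => ?_
        rw [if_pos ((hmax i hi).trans hq)]
      · rw [if_neg hq, zero_add]
        exact le_max_of_le_left (hB ε q)
    · intro ε a' ha' b
      rw [Finset.mem_insert, not_or] at ha'
      have h1 : S (Function.update ε a' b) = S ε := by
        refine Finset.sum_congr rfl fun i hi => ?_
        rw [Function.update_of_ne (by rintro rfl; exact ha'.2 hi)]
      dsimp only
      rw [hupd ε a' ha'.2 b, h1, Function.update_of_ne (Ne.symm ha'.1)]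
    · simp only [Finset.sum_insert ha]
      change ∑ ε, (4 * (boolSign (ε a) * y a + S ε) ^ 2
        - 4 * max (B ε) |boolSign (ε a) * y a + S ε| * |boolSign (ε a) * y a + S ε|
        + 2 * max (B ε) |boolSign (ε a) * y a + S ε| ^ 2) ≤ _
      have step1 : ∀ ε, (4 * (boolSign (ε a) * y a + S ε) ^ 2
          - 4 * max (B ε) |boolSign (ε a) * y a + S ε| * |boolSign (ε a) * y a + S ε|
          + 2 * max (B ε) |boolSign (ε a) * y a + S ε| ^ 2)
          ≤ 4 * (boolSign (ε a) * y a + S ε) ^ 2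
          - 4 * B ε * |boolSign (ε a) * y a + S ε| + 2 * B ε ^ 2 := by
        intro ε
        rcases le_total (B ε) |boolSign (ε a) * y a + S ε| with h | h
        · rw [max_eq_right h]
          nlinarith [sq_nonneg (|boolSign (ε a) * y a + S ε| - B ε)]
        · rw [max_eq_left h]
      set F : (Fin n → Bool) → ℝ := fun ε => 4 * (boolSign (ε a) * y a + S ε) ^ 2
          - 4 * B ε * |boolSign (ε a) * y a + S ε| + 2 * B ε ^ 2 with hF
      have hinv : Function.Involutive
          (fun ε : Fin n → Bool => Function.update ε a (!(ε a))) := by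
        intro ε; simp
      have hflip : ∑ ε, F ε = ∑ ε, F (Function.update ε a (!(ε a))) :=
        (Equiv.sum_comp hinv.toPerm F).symm
      have step2 : ∀ ε, F ε + F (Function.update ε a (!(ε a))) ≤
          2 * ((4 * S ε ^ 2 - 4 * B ε * |S ε| + 2 * B ε ^ 2) + 4 * y a ^ 2) := by
        intro ε
        have h1 : S (Function.update ε a (!(ε a))) = S ε := by
          refine Finset.sum_congr rfl fun i hi => ?_
          rw [Function.update_of_ne (by rintro rfl; exact ha hi)]
        simp only [hF, h1, hupd ε a ha, Function.update_self, boolSign_not]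
        set e := boolSign (ε a)
        have he : e ^ 2 = 1 := boolSign_sq _
        have habs : 2 * |S ε| ≤ |e * y a + S ε| + |-e * y a + S ε| := by
          have := abs_add_le (e * y a + S ε) (-e * y a + S ε)
          rw [show (e * y a + S ε) + (-e * y a + S ε) = 2 * S ε by ring, abs_mul, abs_two] at this
          exact this
        have := mul_le_mul_of_nonneg_left habs (hB0 ε)
        have h3 : (e * y a) ^ 2 = y a ^ 2 := by rw [mul_pow, he, one_mul]
        nlinarith
      have h4 : ∑ ε, F ε ≤ ∑ ε, ((4 * S ε ^ 2 - 4 * B ε * |S ε| + 2 * B ε ^ 2) + 4 * y a ^ 2) := by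
        have h5 := Finset.sum_le_sum fun ε (_ : ε ∈ Finset.univ) => step2 ε
        rw [Finset.sum_add_distrib, ← hflip, ← Finset.mul_sum] at h5
        linarith
      refine (Finset.sum_le_sum fun ε _ => step1 ε).trans (h4.trans ?_)
      rw [Finset.sum_add_distrib]
      simp only [mul_add, Finset.sum_add_distrib]
      simp only [Finset.sum_add_distrib] at hsum
      linarith

theorem exists_prefix_bound {n : ℕ} (x y : Fin n → ℝ) :
    ∃ B : (Fin n → Bool) → ℝ,
      (∀ ε q, |∑ i, (if x i ≤ q then boolSign (ε i) * y i else 0)| ≤ B ε) ∧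
      ∑ ε, B ε ^ 2 ≤ ∑ _ε : Fin n → Bool, 4 * ∑ i, y i ^ 2 := by
  obtain ⟨B, h1, -, h3⟩ := exists_prefix_bound_aux x y Finset.univ
  refine ⟨B, h1, le_trans (Finset.sum_le_sum fun ε _ => ?_) h3⟩
  set S := ∑ i, boolSign (ε i) * y i
  nlinarith [sq_nonneg (B ε - 2 * |S|), sq_abs S]

/-! ### Symmetrization -/

/-- `ψ` truncated to the half-line `(-∞, q]`. -/
noncomputable def truncBelow (ψ : ℝ → ℝ) (q : ℝ) (x : ℝ) : ℝ := if x ≤ q then ψ x else 0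

theorem measurable_truncBelow {ψ : ℝ → ℝ} (hψ : Measurable ψ) (q : ℝ) :
    Measurable (truncBelow ψ q) :=
  Measurable.ite measurableSet_Iic hψ measurable_const

theorem truncBelow_eq_indicator (ψ : ℝ → ℝ) (q : ℝ) :
    truncBelow ψ q = (Iic q).indicator ψ := by
  ext x; simp [truncBelow, indicator_apply]

theorem integrable_truncBelow {ν : Measure ℝ} {ψ : ℝ → ℝ} (hψ : Integrable ψ ν) (q : ℝ) :
    Integrable (truncBelow ψ q) ν := by
  rw [truncBelow_eq_indicator]; exact hψ.indicator measurableSet_Iic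

theorem lintegral_signed_sum_le {ν : Measure ℝ} [IsProbabilityMeasure ν] {ψ : ℝ → ℝ}
    (hψm : Measurable ψ) (hψ2 : MemLp ψ 2 ν) {n : ℕ} (hn : 0 < n) :
    ∑ ε : Fin n → Bool, ∫⁻ x : Fin n → ℝ, (⨆ q : ℚ,
      ‖∑ i, boolSign (ε i) * truncBelow ψ q (x i)‖ₑ) ∂(Measure.pi fun _ => ν)
      ≤ ∑ _ε : Fin n → Bool, ENNReal.ofReal (√n * (4 * ∫ x, ψ x ^ 2 ∂ν + 1)) := by
  have hsn : 0 < √(n : ℝ) := Real.sqrt_pos.2 (by exact_mod_cast hn)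
  have hsq : √(n : ℝ) * √(n : ℝ) = n := Real.mul_self_sqrt (by positivity)
  have hmeas : ∀ (ε : Fin n → Bool), Measurable fun x : Fin n → ℝ => ⨆ q : ℚ,
      ‖∑ i, boolSign (ε i) * truncBelow ψ q (x i)‖ₑ := by
    intro ε
    refine Measurable.iSup fun q => Measurable.enorm (Finset.measurable_sum _ fun i _ => ?_)
    exact ((measurable_truncBelow hψm q).comp (measurable_pi_apply i)).const_mul _
  rw [← lintegral_finsetSum _ fun ε _ => hmeas ε]
  have hpt : ∀ x : Fin n → ℝ, ∑ ε : Fin n → Bool, (⨆ q : ℚ,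
      ‖∑ i, boolSign (ε i) * truncBelow ψ q (x i)‖ₑ) ≤
      ∑ _ε : Fin n → Bool, ENNReal.ofReal ((√n)⁻¹ * (4 * ∑ i, ψ (x i) ^ 2) + √n) := by
    intro x
    obtain ⟨B, hB, hB2⟩ := exists_prefix_bound x (fun i => ψ (x i))
    have h1 : ∀ ε : Fin n → Bool, (⨆ q : ℚ,
      ‖∑ i, boolSign (ε i) * truncBelow ψ q (x i)‖ₑ) ≤
        ENNReal.ofReal ((√n)⁻¹ * B ε ^ 2 + √n) := by
      intro ε
      refine iSup_le fun q => ?_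
      rw [Real.enorm_eq_ofReal_abs]
      refine ENNReal.ofReal_le_ofReal ?_
      have h2 : |∑ i, boolSign (ε i) * truncBelow ψ q (x i)| ≤ B ε := by
        refine le_trans (le_of_eq ?_) (hB ε q)
        congr 1
        refine Finset.sum_congr rfl fun i _ => ?_
        simp [truncBelow]
      refine h2.trans ?_
      have h3 : 0 ≤ (√n)⁻¹ * (B ε - √n) ^ 2 := by positivity
      have h4 : (√n)⁻¹ * (B ε - √n) ^ 2 = (√n)⁻¹ * B ε ^ 2 - 2 * B ε + √n := by
        field_simp; ring
      have h5 : 0 ≤ B ε := (abs_nonneg _).trans h2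
      linarith
    refine (Finset.sum_le_sum fun ε _ => h1 ε).trans ?_
    rw [← ENNReal.ofReal_sum_of_nonneg (fun ε _ => by positivity),
      ← ENNReal.ofReal_sum_of_nonneg (fun ε _ => by positivity)]
    refine ENNReal.ofReal_le_ofReal ?_
    rw [Finset.sum_add_distrib, Finset.sum_add_distrib, ← Finset.mul_sum, ← Finset.mul_sum]
    gcongr
  refine (lintegral_mono hpt).trans ?_
  have hint : ∀ i : Fin n, Integrable (fun x : Fin n → ℝ => ψ (x i) ^ 2)
      (Measure.pi fun _ => ν) := fun i =>
    (measurePreserving_eval (fun _ : Fin n => ν) i).integrable_comp_of_integrable hψ2.integrable_sq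
  have hval : ∀ i : Fin n, ∫ x : Fin n → ℝ, ψ (x i) ^ 2 ∂(Measure.pi fun _ => ν)
      = ∫ x, ψ x ^ 2 ∂ν := by
    intro i
    have := integral_map (μ := Measure.pi fun _ : Fin n => ν) (φ := Function.eval i)
      (measurable_pi_apply i).aemeasurable (f := fun x => ψ x ^ 2)
      (hψm.pow_const 2).aestronglyMeasurable
    rw [(measurePreserving_eval (fun _ : Fin n => ν) i).map_eq] at this
    exact this.symm
  rw [lintegral_finsetSum]
  · refine Finset.sum_le_sum fun ε _ => ?_
    rw [← ofReal_integral_eq_lintegral_ofReal]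
    · refine ENNReal.ofReal_le_ofReal ?_
      rw [integral_add, integral_const_mul, integral_const_mul, integral_finsetSum _
        (fun i _ => hint i)]
      · simp only [hval, Finset.sum_const, Finset.card_univ, Fintype.card_fin, integral_const,
          probReal_univ, smul_eq_mul, one_mul, nsmul_eq_mul]
        apply le_of_eq
        have : (n : ℝ) = √n * √n := hsq.symm
        field_simp
        rw [Real.sq_sqrt (by positivity)]
        ring
      · exact ((integrable_finsetSum _ fun i _ => hint i).const_mul _).const_mul _
      · exact integrable_const _
    · exact (((integrable_finsetSum _ fun i _ => hint i).const_mul _).const_mul _).add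
        (integrable_const _)
    · exact Eventually.of_forall fun x => by positivity
  · intro ε _
    refine ENNReal.measurable_ofReal.comp ?_
    refine Measurable.add_const (Measurable.const_mul (Measurable.const_mul
      (Finset.measurable_sum _ fun i _ => ?_) _) _) _
    exact (hψm.comp (measurable_pi_apply i)).pow_const 2

theorem measurePreserving_swap_coordinates {ν : Measure ℝ} [IsProbabilityMeasure ν] {n : ℕ}
    (ε : Fin n → Bool) :
    MeasurePreserving (fun (z : Fin n → ℝ × ℝ) i => if ε i then z i else (z i).swap)
      (Measure.pi fun _ => ν.prod ν) (Measure.pi fun _ => ν.prod ν) := by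
  refine measurePreserving_pi (fun _ : Fin n => ν.prod ν) (fun _ : Fin n => ν.prod ν)
    (f := fun i z => if ε i then z else z.swap) fun i => ?_
  cases ε i
  · exact Measure.measurePreserving_swap
  · exact MeasurePreserving.id _

theorem lintegral_pi_prod {ν : Measure ℝ} [IsProbabilityMeasure ν] {n : ℕ}
    {F : (Fin n → ℝ) × (Fin n → ℝ) → ℝ≥0∞} (hF : Measurable F) :
    ∫⁻ z : Fin n → ℝ × ℝ, F (fun i => (z i).1, fun i => (z i).2) ∂(Measure.pi fun _ => ν.prod ν)
      = ∫⁻ p, F p ∂((Measure.pi fun _ => ν).prod (Measure.pi fun _ => ν)) :=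
  (measurePreserving_arrowProdEquivProdArrow ℝ ℝ (Fin n) (fun _ => ν)
    (fun _ => ν)).lintegral_comp hF

theorem lintegral_lintegral_swap_coordinates {ν : Measure ℝ} [IsProbabilityMeasure ν] {n : ℕ}
    (ε : Fin n → Bool) {F : (Fin n → ℝ) × (Fin n → ℝ) → ℝ≥0∞} (hF : Measurable F) :
    ∫⁻ p, F p ∂((Measure.pi fun _ => ν).prod (Measure.pi fun _ => ν))
      = ∫⁻ z : Fin n → ℝ × ℝ, F (fun i => (if ε i then z i else (z i).swap).1,
          fun i => (if ε i then z i else (z i).swap).2) ∂(Measure.pi fun _ => ν.prod ν) := by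
  rw [← lintegral_pi_prod hF]
  have hm : Measurable fun z : Fin n → ℝ × ℝ => F (fun i => (z i).1, fun i => (z i).2) :=
    hF.comp (by fun_prop)
  exact ((measurePreserving_swap_coordinates (ν := ν) ε).lintegral_comp hm).symm

/-- Symmetrization: the expected uniform deviation over half-lines is of order `√n`. -/
theorem lintegral_deviation_le {ν : Measure ℝ} [IsProbabilityMeasure ν] {ψ : ℝ → ℝ}
    (hψm : Measurable ψ) (hψ2 : MemLp ψ 2 ν) {n : ℕ} (hn : 0 < n) :
    ∫⁻ x : Fin n → ℝ, (⨆ q : ℚ,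
      ‖∑ i, (truncBelow ψ q (x i) - ∫ y, truncBelow ψ q y ∂ν)‖ₑ) ∂(Measure.pi fun _ => ν)
      ≤ 2 * ENNReal.ofReal (√n * (4 * ∫ x, ψ x ^ 2 ∂ν + 1)) := by
  have hψ1 : Integrable ψ ν := hψ2.integrable one_le_two
  have hht : ∀ q, Measurable (truncBelow ψ q) := measurable_truncBelow hψm
  set Q := Measure.pi fun _ : Fin n => ν with hQ
  set G : (Fin n → ℝ) → (Fin n → ℝ) → ℝ≥0∞ := fun x x' => ⨆ q : ℚ,
    ‖∑ i, (truncBelow ψ q (x i) - truncBelow ψ q (x' i))‖ₑ with hG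
  have hGm : Measurable (Function.uncurry G) := by
    refine Measurable.iSup fun q => Measurable.enorm (Finset.measurable_sum _ fun i _ => ?_)
    exact ((hht q).comp ((measurable_pi_apply i).comp measurable_fst)).sub
      ((hht q).comp ((measurable_pi_apply i).comp measurable_snd))
  have hint : ∀ (q : ℚ) (i : Fin n), Integrable (fun x : Fin n → ℝ => truncBelow ψ q (x i)) Q :=
    fun q i => (measurePreserving_eval (fun _ : Fin n => ν) i).integrable_comp_of_integrable
      (integrable_truncBelow hψ1 q)
  have hval : ∀ (q : ℚ) (i : Fin n), ∫ x : Fin n → ℝ, truncBelow ψ q (x i) ∂Q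
      = ∫ x, truncBelow ψ q x ∂ν := by
    intro q i
    have := integral_map (μ := Q) (φ := Function.eval i)
      (measurable_pi_apply i).aemeasurable (f := truncBelow ψ q)
      (hht q).aestronglyMeasurable
    rw [(measurePreserving_eval (fun _ : Fin n => ν) i).map_eq] at this
    exact this.symm
  have h1 : ∀ x : Fin n → ℝ, (⨆ q : ℚ,
      ‖∑ i, (truncBelow ψ q (x i) - ∫ y, truncBelow ψ q y ∂ν)‖ₑ) ≤ ∫⁻ x', G x x' ∂Q := by
    intro x
    refine iSup_le fun q => ?_
    have : ∑ i, (truncBelow ψ q (x i) - ∫ y, truncBelow ψ q y ∂ν)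
        = ∫ x', ∑ i, (truncBelow ψ q (x i) - truncBelow ψ q (x' i)) ∂Q := by
      rw [integral_finsetSum Finset.univ (f := fun i (x' : Fin n → ℝ) =>
        truncBelow ψ q (x i) - truncBelow ψ q (x' i))
        fun i _ => (integrable_const _).sub (hint q i)]
      refine Finset.sum_congr rfl fun i _ => ?_
      rw [integral_sub (integrable_const _) (hint q i), hval]
      simp
    rw [this]
    refine (enorm_integral_le_lintegral_enorm _).trans (lintegral_mono fun x' => ?_)
    exact le_iSup (fun q : ℚ => ‖∑ i, (truncBelow ψ q (x i) - truncBelow ψ q (x' i))‖ₑ) q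
  refine (lintegral_mono h1).trans ?_
  set H : (Fin n → Bool) → (Fin n → ℝ) → ℝ≥0∞ := fun ε x => ⨆ q : ℚ,
      ‖∑ i, boolSign (ε i) * truncBelow ψ q (x i)‖ₑ with hH
  have hHm : ∀ ε, Measurable (H ε) := by
    intro ε
    refine Measurable.iSup fun q => Measurable.enorm (Finset.measurable_sum _ fun i _ => ?_)
    exact ((hht q).comp (measurable_pi_apply i)).const_mul _
  have hfst : MeasurePreserving (Prod.fst : (Fin n → ℝ) × (Fin n → ℝ) → Fin n → ℝ) (Q.prod Q) Q :=
    measurePreserving_fst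
  have hsnd : MeasurePreserving (Prod.snd : (Fin n → ℝ) × (Fin n → ℝ) → Fin n → ℝ) (Q.prod Q) Q :=
    measurePreserving_snd
  have h2 : ∀ ε : Fin n → Bool, ∫⁻ x, ∫⁻ x', G x x' ∂Q ∂Q ≤ 2 * ∫⁻ x, H ε x ∂Q := by
    intro ε
    have e1 : ∫⁻ x, ∫⁻ x', G x x' ∂Q ∂Q = ∫⁻ z, Function.uncurry G z ∂(Q.prod Q) :=
      (lintegral_prod _ hGm.aemeasurable).symm
    have e3 := lintegral_lintegral_swap_coordinates (ν := ν) ε hGm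
    have hm4 : Measurable fun p : (Fin n → ℝ) × (Fin n → ℝ) => H ε p.1 + H ε p.2 :=
      ((hHm ε).comp measurable_fst).add ((hHm ε).comp measurable_snd)
    rw [e1, e3]
    have e5 := lintegral_pi_prod (ν := ν) hm4
    calc ∫⁻ z : Fin n → ℝ × ℝ, G (fun i => (if ε i then z i else (z i).swap).1)
          (fun i => (if ε i then z i else (z i).swap).2) ∂(Measure.pi fun _ => ν.prod ν)
        ≤ ∫⁻ z : Fin n → ℝ × ℝ, (H ε (fun i => (z i).1) + H ε (fun i => (z i).2))
          ∂(Measure.pi fun _ => ν.prod ν) := by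
          refine lintegral_mono fun z => iSup_le fun q => ?_
          have : ∑ i, (truncBelow ψ q (if ε i then z i else (z i).swap).1
              - truncBelow ψ q (if ε i then z i else (z i).swap).2)
              = ∑ i, boolSign (ε i) * truncBelow ψ q (z i).1
                - ∑ i, boolSign (ε i) * truncBelow ψ q (z i).2 := by
            rw [← Finset.sum_sub_distrib]
            refine Finset.sum_congr rfl fun i _ => ?_
            cases ε i
            · simp [boolSign]; ring
            · simp [boolSign]
          rw [this]
          refine enorm_sub_le.trans (add_le_add ?_ ?_)
          · exact le_iSup (fun q : ℚ => ‖∑ i, boolSign (ε i) * truncBelow ψ q (z i).1‖ₑ) q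
          · exact le_iSup (fun q : ℚ => ‖∑ i, boolSign (ε i) * truncBelow ψ q (z i).2‖ₑ) q
      _ = ∫⁻ p, (H ε p.1 + H ε p.2) ∂(Q.prod Q) := e5
      _ = 2 * ∫⁻ x, H ε x ∂Q := by
          rw [lintegral_add_left (f := fun p : (Fin n → ℝ) × (Fin n → ℝ) => H ε p.1)
            ((hHm ε).comp measurable_fst), hfst.lintegral_comp (hHm ε),
            hsnd.lintegral_comp (hHm ε), two_mul]
  have h3 := lintegral_signed_sum_le hψm hψ2 hn
  have h4 := (Finset.sum_le_sum fun ε (_ : ε ∈ Finset.univ) => h2 ε).trans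
    ((Finset.mul_sum _ _ _).symm.le.trans (mul_le_mul_right h3 2))
  rw [Finset.mul_sum] at h4
  simp only [Finset.sum_const, nsmul_eq_mul] at h4
  refine (ENNReal.mul_le_mul_iff_right ?_ ?_).1 h4
  · simp
  · exact ENNReal.natCast_ne_top _

/-! ### Uniform deviations over half-lines for an i.i.d. sample -/

/-- The largest deviation between sample mean and mean of `ψ` truncated to a half-line. -/
noncomputable def halfLineDev (ν : Measure ℝ) (ψ : ℝ → ℝ) {n : ℕ} (x : Fin n → ℝ) : ℝ≥0∞ :=
  ⨆ q : ℚ, ‖sampleMean x (truncBelow ψ q) - ∫ y, truncBelow ψ q y ∂ν‖ₑ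

theorem sampleMean_sub_eq {n : ℕ} (hn : 0 < n) (x : Fin n → ℝ) (h : ℝ → ℝ) (r : ℝ) :
    sampleMean x h - r = (1 / (n : ℝ)) * ∑ i, (h (x i) - r) := by
  have : (n : ℝ) ≠ 0 := by positivity
  simp only [sampleMean, Finset.sum_sub_distrib, Finset.sum_const, Finset.card_univ,
    Fintype.card_fin, nsmul_eq_mul]
  field_simp

section Sample

variable {Ω : Type*} [MeasurableSpace Ω] {P : Measure Ω}
  {ν : Measure ℝ} {X : ℕ → Ω → ℝ}

theorem ae_forall_sample (hX : ∀ i, HasLaw (X i) ν P) {p : ℝ → Prop} (hp : ∀ᵐ x ∂ν, p x) :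
    ∀ᵐ ω ∂P, ∀ i, p (X i ω) := by
  refine ae_all_iff.2 fun i => ?_
  have := (hX i).map_eq ▸ hp
  exact ae_of_ae_map (hX i).aemeasurable this

theorem halfLineDev_congr {ψ ψ' : ℝ → ℝ} (h : ψ =ᵐ[ν] ψ') {n : ℕ} {x : Fin n → ℝ}
    (hx : ∀ i, ψ (x i) = ψ' (x i)) : halfLineDev ν ψ x = halfLineDev ν ψ' x := by
  unfold halfLineDev
  congr 1
  ext q
  have h1 : sampleMean x (truncBelow ψ q) = sampleMean x (truncBelow ψ' q) := by
    simp only [sampleMean, truncBelow, hx]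
  have h2 : ∫ y, truncBelow ψ q y ∂ν = ∫ y, truncBelow ψ' q y ∂ν := by
    refine integral_congr_ae ?_
    filter_upwards [h] with y hy
    simp [truncBelow, hy]
  rw [h1, h2]

theorem measurable_halfLineDev {ψ : ℝ → ℝ} (hψ : Measurable ψ) (n : ℕ) :
    Measurable fun x : Fin n → ℝ => halfLineDev ν ψ x := by
  refine Measurable.iSup fun q => Measurable.enorm (Measurable.sub_const ?_ _)
  refine Measurable.const_mul (Finset.measurable_sum _ fun i _ => ?_) _
  exact (measurable_truncBelow hψ q).comp (measurable_pi_apply i)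

theorem ae_halfLineDev_eq (hX : ∀ i, HasLaw (X i) ν P) {ψ ψ' : ℝ → ℝ} (h : ψ =ᵐ[ν] ψ') :
    ∀ᵐ ω ∂P, ∀ n, halfLineDev ν ψ (fun i : Fin n => X i ω)
      = halfLineDev ν ψ' (fun i : Fin n => X i ω) := by
  filter_upwards [ae_forall_sample hX h] with ω hω n
  exact halfLineDev_congr h fun i => hω i

theorem aemeasurable_halfLineDev (hX : ∀ i, HasLaw (X i) ν P) {ψ : ℝ → ℝ}
    (hψ : AEMeasurable ψ ν) (n : ℕ) :
    AEMeasurable (fun ω => halfLineDev ν ψ (fun i : Fin n => X i ω)) P := by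
  have h1 : AEMeasurable (fun ω => halfLineDev ν (hψ.mk ψ) (fun i : Fin n => X i ω)) P :=
    (measurable_halfLineDev hψ.measurable_mk n).comp_aemeasurable
      (aemeasurable_pi_lambda _ fun i : Fin n => (hX i).aemeasurable)
  refine h1.congr ?_
  filter_upwards [ae_halfLineDev_eq hX hψ.ae_eq_mk] with ω hω
  exact (hω n).symm

theorem lintegral_halfLineDev_le [IsProbabilityMeasure P] [IsProbabilityMeasure ν] (hX : ∀ i, HasLaw (X i) ν P)
    (hind : iIndepFun X P) {ψ : ℝ → ℝ} (hψ : MemLp ψ 2 ν) {n : ℕ} (hn : 0 < n) :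
    ∫⁻ ω, halfLineDev ν ψ (fun i : Fin n => X i ω) ∂P
      ≤ ENNReal.ofReal (2 * (4 * ∫ x, ψ x ^ 2 ∂ν + 1) / √n) := by
  have hψm : AEMeasurable ψ ν := hψ.aestronglyMeasurable.aemeasurable
  have hmk := hψm.ae_eq_mk
  set ψ' := hψm.mk ψ
  have hψ'm : Measurable ψ' := hψm.measurable_mk
  have hψ' : MemLp ψ' 2 ν := (memLp_congr_ae hmk).1 hψ
  have hsq : ∫ x, ψ x ^ 2 ∂ν = ∫ x, ψ' x ^ 2 ∂ν :=
    integral_congr_ae (by filter_upwards [hmk] with x hx; rw [hx])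
  have hXm : ∀ i : Fin n, AEMeasurable (X i) P := fun i => (hX i).aemeasurable
  have hlaw : P.map (fun ω (i : Fin n) => X i ω) = Measure.pi fun _ => ν := by
    have hi : iIndepFun (fun i : Fin n => X i) P :=
      hind.precomp (g := fun i : Fin n => (i : ℕ)) Fin.val_injective
    rw [(iIndepFun_iff_map_fun_eq_pi_map hXm).1 hi]
    congr 1
    ext1 i
    exact (hX i).map_eq
  have hn' : (0 : ℝ) < n := by exact_mod_cast hn
  have hsn : 0 < √(n : ℝ) := Real.sqrt_pos.2 hn'
  calc ∫⁻ ω, halfLineDev ν ψ (fun i : Fin n => X i ω) ∂P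
      = ∫⁻ ω, halfLineDev ν ψ' (fun i : Fin n => X i ω) ∂P := by
        refine lintegral_congr_ae ?_
        filter_upwards [ae_halfLineDev_eq hX hmk] with ω hω using hω n
    _ = ∫⁻ x, halfLineDev ν ψ' x ∂(Measure.pi fun _ : Fin n => ν) := by
        rw [← hlaw]
        exact (lintegral_map' (measurable_halfLineDev hψ'm n).aemeasurable
          (aemeasurable_pi_lambda _ hXm)).symm
    _ = ∫⁻ x, ENNReal.ofReal (1 / n) * (⨆ q : ℚ,
          ‖∑ i, (truncBelow ψ' q (x i) - ∫ y, truncBelow ψ' q y ∂ν)‖ₑ)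
          ∂(Measure.pi fun _ : Fin n => ν) := by
        refine lintegral_congr fun x => ?_
        rw [ENNReal.mul_iSup]
        refine iSup_congr fun q => ?_
        rw [sampleMean_sub_eq hn, enorm_mul, Real.enorm_eq_ofReal (by positivity)]
    _ ≤ ENNReal.ofReal (1 / n) * (2 * ENNReal.ofReal (√n * (4 * ∫ x, ψ' x ^ 2 ∂ν + 1))) := by
        rw [lintegral_const_mul' _ _ ENNReal.ofReal_ne_top]
        exact mul_le_mul_right (lintegral_deviation_le hψ'm hψ' hn) _
    _ = ENNReal.ofReal (2 * (4 * ∫ x, ψ x ^ 2 ∂ν + 1) / √n) := by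
        have h0 : 0 ≤ ∫ x, ψ' x ^ 2 ∂ν := integral_nonneg fun _ => sq_nonneg _
        rw [← ENNReal.ofReal_ofNat 2, ← ENNReal.ofReal_mul (by norm_num),
          ← ENNReal.ofReal_mul (by positivity), hsq]
        congr 1
        have : (n : ℝ) = √n * √n := (Real.mul_self_sqrt hn'.le).symm
        field_simp
        rw [Real.sq_sqrt hn'.le]

end Sample

/-! ### A weighted Glivenko-Cantelli theorem -/

/-- Pólya: monotone functions converging on the rationals to a continuous function converge
uniformly on compact intervals. -/
theorem tendstoUniformlyOn_of_monotone_of_rat {F : ℕ → ℝ → ℝ} {G : ℝ → ℝ}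
    (hF : ∀ n, Monotone (F n)) (hG : Continuous G)
    (h : ∀ q : ℚ, Tendsto (fun n => F n q) atTop (𝓝 (G q))) (a b : ℝ) :
    TendstoUniformlyOn F G atTop (Icc a b) := by
  rw [← tendstoLocallyUniformlyOn_iff_tendstoUniformlyOn_of_compact isCompact_Icc,
    Metric.tendstoLocallyUniformlyOn_iff]
  intro ε hε t _
  obtain ⟨δ, hδ, hδt⟩ := Metric.continuous_iff.1 hG t (ε / 4) (by positivity)
  obtain ⟨q₁, hq₁, hq₁'⟩ := exists_rat_btwn (show t - δ < t by linarith)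
  obtain ⟨q₂, hq₂, hq₂'⟩ := exists_rat_btwn (show t < t + δ by linarith)
  have hnear : ∀ y ∈ Icc (q₁ : ℝ) q₂, |G y - G t| < ε / 4 := by
    intro y hy
    have := hδt y (by rw [Real.dist_eq, abs_lt]; constructor <;> linarith [hy.1, hy.2])
    rwa [Real.dist_eq] at this
  refine ⟨Ioo (q₁ : ℝ) q₂, mem_nhdsWithin_of_mem_nhds (Ioo_mem_nhds hq₁' hq₂), ?_⟩
  filter_upwards [Metric.tendsto_nhds.1 (h q₁) (ε / 4) (by positivity),
    Metric.tendsto_nhds.1 (h q₂) (ε / 4) (by positivity)] with n h1 h2 y hy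
  have hq : (q₁ : ℝ) ≤ q₂ := (hq₁'.trans hq₂).le
  have m1 := hF n hy.1.le
  have m2 := hF n hy.2.le
  have g0 := abs_lt.1 (hnear y ⟨hy.1.le, hy.2.le⟩)
  have g1 := abs_lt.1 (hnear q₁ ⟨le_rfl, hq⟩)
  have g2 := abs_lt.1 (hnear q₂ ⟨hq, le_rfl⟩)
  rw [Real.dist_eq] at h1 h2 ⊢
  have h1' := abs_lt.1 h1
  have h2' := abs_lt.1 h2
  rw [abs_lt]
  constructor <;> linarith

theorem continuous_integral_truncBelow {ν : Measure ℝ} [NullSingletonClass ν] {ψ : ℝ → ℝ}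
    (hψ : Integrable ψ ν) : Continuous fun t => ∫ y, truncBelow ψ t y ∂ν := by
  refine continuous_iff_continuousAt.2 fun t => ?_
  refine continuousAt_of_dominated (bound := fun y => ‖ψ y‖)
    (Eventually.of_forall fun s => (integrable_truncBelow hψ s).aestronglyMeasurable)
    (Eventually.of_forall fun s => Eventually.of_forall fun y => ?_) hψ.norm ?_
  · simp only [truncBelow]; split_ifs
    · exact le_rfl
    · simp
  · have : ∀ᵐ y ∂ν, y ≠ t := by
      rw [ae_iff]; simp
    filter_upwards [this] with y hy
    rcases lt_or_gt_of_ne hy with h | h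
    · refine (continuousAt_const (y := ψ y)).congr ?_
      filter_upwards [Ioi_mem_nhds h] with s hs
      simp [truncBelow, (mem_Ioi.1 hs).le]
    · refine (continuousAt_const (y := (0 : ℝ))).congr ?_
      filter_upwards [Iio_mem_nhds h] with s hs
      simp [truncBelow, not_le.2 (mem_Iio.1 hs)]

theorem monotone_truncBelow {ψ : ℝ → ℝ} (hψ : ∀ x, 0 ≤ ψ x) (x : ℝ) :
    Monotone fun t => truncBelow ψ t x := by
  intro s t hst
  simp only [truncBelow]
  split_ifs with h1 h2 h2
  · exact le_rfl
  · exact absurd (h1.trans hst) h2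
  · exact hψ x
  · exact le_rfl

theorem monotone_sampleMean_truncBelow {ψ : ℝ → ℝ} (hψ : ∀ x, 0 ≤ ψ x) {n : ℕ} (x : Fin n → ℝ) :
    Monotone fun t => sampleMean x (truncBelow ψ t) := by
  intro s t hst
  refine mul_le_mul_of_nonneg_left (Finset.sum_le_sum fun i _ => ?_) (by positivity)
  exact monotone_truncBelow hψ (x i) hst

section

variable {Ω : Type*} [MeasurableSpace Ω] {P : Measure Ω} {ν : Measure ℝ} {X : ℕ → Ω → ℝ}

theorem ae_tendsto_sampleMean (hX : ∀ i, HasLaw (X i) ν P)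
    (hind : iIndepFun X P) {h : ℝ → ℝ} (hm : Measurable h) (hi : Integrable h ν) :
    ∀ᵐ ω ∂P, Tendsto (fun n => sampleMean (fun i : Fin n => X i ω) h) atTop (𝓝 (∫ y, h y ∂ν)) := by
  have hident : ∀ i, IdentDistrib (X i) (X 0) P P := fun i =>
    ⟨(hX i).aemeasurable, (hX 0).aemeasurable, by rw [(hX i).map_eq, (hX 0).map_eq]⟩
  have hint : Integrable (fun ω => h (X 0 ω)) P := by
    have : Integrable h (P.map (X 0)) := by rw [(hX 0).map_eq]; exact hi
    exact this.comp_aemeasurable (hX 0).aemeasurable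
  have hval : ∫ ω, h (X 0 ω) ∂P = ∫ y, h y ∂ν := by
    rw [← (hX 0).map_eq, integral_map (hX 0).aemeasurable hm.aestronglyMeasurable]
  have := strong_law_ae_real (fun i ω => h (X i ω)) hint
    (fun i j hij => ((hind.indepFun hij).comp hm hm)) (fun i => (hident i).comp hm)
  filter_upwards [this] with ω hω
  rw [← hval]
  refine hω.congr fun n => ?_
  rw [sampleMean, Finset.sum_range, div_eq_inv_mul, one_div]

theorem ae_tendsto_halfLine_of_nonneg [NullSingletonClass ν] (hX : ∀ i, HasLaw (X i) ν P)
    (hind : iIndepFun X P) {ψ : ℝ → ℝ} (hm : Measurable ψ) (hi : Integrable ψ ν)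
    (h0 : ∀ x, 0 ≤ ψ x) (a b : ℝ) :
    ∀ᵐ ω ∂P, TendstoUniformlyOn (fun n t => sampleMean (fun i : Fin n => X i ω) (truncBelow ψ t))
      (fun t => ∫ y, truncBelow ψ t y ∂ν) atTop (Icc a b) := by
  have := ae_all_iff.2 fun q : ℚ => ae_tendsto_sampleMean hX hind
    (measurable_truncBelow hm q) (integrable_truncBelow hi q)
  filter_upwards [this] with ω hω
  exact tendstoUniformlyOn_of_monotone_of_rat
    (fun n => monotone_sampleMean_truncBelow h0 _) (continuous_integral_truncBelow hi) hω a b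

theorem ae_tendsto_halfLineDev [NullSingletonClass ν] (hX : ∀ i, HasLaw (X i) ν P)
    (hind : iIndepFun X P) {ψ : ℝ → ℝ} (hi : Integrable ψ ν)
    {a b : ℝ} (hab : a ≤ b) (hν : ∀ᵐ x ∂ν, x ∈ Icc a b) :
    ∀ᵐ ω ∂P, Tendsto (fun n => halfLineDev ν ψ (fun i : Fin n => X i ω)) atTop (𝓝 0) := by
  have hψm : AEMeasurable ψ ν := hi.aestronglyMeasurable.aemeasurable
  have hmk := hψm.ae_eq_mk
  set ψ' := hψm.mk ψ
  have hm : Measurable ψ' := hψm.measurable_mk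
  have hi' : Integrable ψ' ν := hi.congr hmk
  have hp := ae_tendsto_halfLine_of_nonneg hX hind (hm.max measurable_const) hi'.pos_part
    (fun x => le_max_right _ _) a b
  have hq := ae_tendsto_halfLine_of_nonneg hX hind (ψ := fun x => max (-ψ' x) 0)
    (hm.neg.max measurable_const) hi'.neg_part
    (fun x => le_max_right _ _) a b
  filter_upwards [hp, hq, ae_halfLineDev_eq hX hmk, ae_forall_sample hX hν] with ω h1 h2 h3 h4
  simp only [h3]
  have hsplit : ∀ t x, truncBelow ψ' t x = truncBelow (fun x => max (ψ' x) 0) t x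
      - truncBelow (fun x => max (-ψ' x) 0) t x := by
    intro t x
    simp only [truncBelow]
    split_ifs
    · rcases le_total (ψ' x) 0 with h | h
      · rw [max_eq_right h, max_eq_left (by linarith)]; ring
      · rw [max_eq_left h, max_eq_right (by linarith)]; ring
    · ring
  have hIcc : TendstoUniformlyOn
      (fun n t => sampleMean (fun i : Fin n => X i ω) (truncBelow ψ' t))
      (fun t => ∫ y, truncBelow ψ' t y ∂ν) atTop (Icc a b) := by
    have := h1.sub h2
    refine (this.congr (Eventually.of_forall fun n t _ => ?_)).congr_right fun t _ => ?_
    · simp only [Pi.sub_apply, sampleMean, hsplit, Finset.sum_sub_distrib]; ring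
    · simp only [Pi.sub_apply]
      rw [← integral_sub (integrable_truncBelow hi'.pos_part t)
        (integrable_truncBelow hi'.neg_part t)]
      exact integral_congr_ae (Eventually.of_forall fun x => (hsplit t x).symm)
  rw [Metric.tendstoUniformlyOn_iff] at hIcc
  rw [ENNReal.tendsto_atTop_zero]
  intro ε hε
  obtain ⟨r, hr0, hrε⟩ : ∃ r : ℝ, 0 < r ∧ ENNReal.ofReal r ≤ ε := by
    rcases eq_or_ne ε ⊤ with rfl | hne
    · exact ⟨1, one_pos, le_top⟩
    · exact ⟨ε.toReal, ENNReal.toReal_pos hε.ne' hne, by rw [ENNReal.ofReal_toReal hne]⟩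
  obtain ⟨N, hN⟩ := eventually_atTop.1 (hIcc r hr0)
  refine ⟨N, fun n hn => iSup_le fun q => ?_⟩
  rw [Real.enorm_eq_ofReal_abs]
  refine le_trans (ENNReal.ofReal_le_ofReal ?_) hrε
  have hproj : ∃ t ∈ Icc a b, (q : ℝ) < a ∨ ∀ x ∈ Icc a b, (x ≤ (q : ℝ) ↔ x ≤ t) := by
    rcases lt_or_ge (q : ℝ) a with h | h
    · exact ⟨a, left_mem_Icc.2 hab, Or.inl h⟩
    · rcases le_total (q : ℝ) b with h' | h'
      · exact ⟨q, ⟨h, h'⟩, Or.inr fun x _ => Iff.rfl⟩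
      · exact ⟨b, right_mem_Icc.2 hab, Or.inr fun x hx => ⟨fun _ => hx.2, fun hh => hh.trans h'⟩⟩
  obtain ⟨t, ht, hlt | heq⟩ := hproj
  · have e1 : sampleMean (fun i : Fin n => X i ω) (truncBelow ψ' q) = 0 := by
      simp only [sampleMean, truncBelow]
      rw [Finset.sum_eq_zero, mul_zero]
      intro i _
      rw [if_neg (not_le.2 (hlt.trans_le (h4 i).1))]
    have e2 : ∫ y, truncBelow ψ' q y ∂ν = 0 := by
      refine integral_eq_zero_of_ae ?_
      filter_upwards [hν] with y hy
      simp [truncBelow, not_le.2 (hlt.trans_le hy.1)]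
    rw [e1, e2]; simpa using hr0.le
  · have e1 : sampleMean (fun i : Fin n => X i ω) (truncBelow ψ' q)
        = sampleMean (fun i : Fin n => X i ω) (truncBelow ψ' t) := by
      simp only [sampleMean, truncBelow]
      congr 1
      refine Finset.sum_congr rfl fun i _ => ?_
      simp only [heq _ (h4 i)]
    have e2 : ∫ y, truncBelow ψ' q y ∂ν = ∫ y, truncBelow ψ' t y ∂ν := by
      refine integral_congr_ae ?_
      filter_upwards [hν] with y hy
      simp only [truncBelow, heq y hy]
    have := hN n hn t ht
    rw [e1, e2, ← Real.dist_eq, dist_comm]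
    exact this.le

end

/-! ### From half-lines to functions whose level sets are intervals -/

/-- The deviation of the sample mean from the mean. -/
noncomputable def meanDev (ν : Measure ℝ) {n : ℕ} (x : Fin n → ℝ) (h : ℝ → ℝ) : ℝ :=
  sampleMean x h - ∫ y, h y ∂ν

theorem sampleMean_sub {n : ℕ} (x : Fin n → ℝ) (h k : ℝ → ℝ) :
    sampleMean x (fun y => h y - k y) = sampleMean x h - sampleMean x k := by
  simp only [sampleMean, Finset.sum_sub_distrib]; ring

theorem sampleMean_const_mul {n : ℕ} (x : Fin n → ℝ) (r : ℝ) (h : ℝ → ℝ) :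
    sampleMean x (fun y => r * h y) = r * sampleMean x h := by
  simp only [sampleMean, ← Finset.mul_sum]; ring

theorem abs_sampleMean_le {n : ℕ} (x : Fin n → ℝ) {h k : ℝ → ℝ} (hk : ∀ i, |h (x i)| ≤ k (x i)) :
    |sampleMean x h| ≤ sampleMean x k := by
  rw [sampleMean, abs_mul, abs_of_nonneg (by positivity : (0 : ℝ) ≤ 1 / n)]
  exact mul_le_mul_of_nonneg_left
    ((Finset.abs_sum_le_sum_abs _ _).trans (Finset.sum_le_sum fun i _ => hk i)) (by positivity)

theorem meanDev_sub {ν : Measure ℝ} {n : ℕ} (x : Fin n → ℝ) {h k : ℝ → ℝ} (hh : Integrable h ν)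
    (hk : Integrable k ν) :
    meanDev ν x (fun y => h y - k y) = meanDev ν x h - meanDev ν x k := by
  simp only [meanDev, sampleMean_sub, integral_sub hh hk]; ring

theorem meanDev_const_mul {ν : Measure ℝ} {n : ℕ} (x : Fin n → ℝ) (r : ℝ) (h : ℝ → ℝ) :
    meanDev ν x (fun y => r * h y) = r * meanDev ν x h := by
  simp only [meanDev, sampleMean_const_mul, integral_const_mul]; ring

theorem meanDev_sum {ν : Measure ℝ} {n : ℕ} (x : Fin n → ℝ) {ι : Type*} (s : Finset ι)
    {h : ι → ℝ → ℝ} (hh : ∀ i ∈ s, Integrable (h i) ν) :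
    meanDev ν x (fun y => ∑ i ∈ s, h i y) = ∑ i ∈ s, meanDev ν x (h i) := by
  simp only [meanDev, sampleMean, integral_finsetSum s hh, Finset.sum_sub_distrib]
  rw [Finset.sum_comm, Finset.mul_sum]

theorem exists_rat_seq_of_isLowerSet {A : Set ℝ} (hA : IsLowerSet A) :
    ∃ q : ℕ → ℚ, ∀ y : ℝ, ∀ᶠ k in atTop, (y ≤ q k ↔ y ∈ A) := by
  rcases A.eq_empty_or_nonempty with rfl | hne
  · refine ⟨fun k => -(k : ℚ), fun y => ?_⟩
    obtain ⟨N, hN⟩ := exists_nat_gt (-y)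
    filter_upwards [eventually_ge_atTop N] with k hk
    simp only [mem_empty_iff_false, iff_false, not_le]
    push_cast
    have : (N : ℝ) ≤ k := by exact_mod_cast hk
    linarith
  by_cases hb : BddAbove A
  · set t := sSup A with ht
    have hle : ∀ y ∈ A, y ≤ t := fun y hy => le_csSup hb hy
    have hlt : ∀ y, y < t → y ∈ A := by
      intro y hy
      obtain ⟨z, hz, hyz⟩ := exists_lt_of_lt_csSup hne hy
      exact hA hyz.le hz
    have htend : Tendsto (fun k : ℕ => (1 : ℝ) / (k + 1)) atTop (𝓝 0) :=
      tendsto_one_div_add_atTop_nhds_zero_nat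
    by_cases htA : t ∈ A
    · choose q hq using fun k : ℕ =>
        exists_rat_btwn (show t < t + 1 / ((k : ℝ) + 1) by linarith [show (0:ℝ) < 1 / ((k : ℝ) + 1) by positivity])
      refine ⟨q, fun y => ?_⟩
      rcases le_or_gt y t with hy | hy
      · filter_upwards with k
        exact ⟨fun _ => hA hy htA, fun _ => hy.trans (hq k).1.le⟩
      · have : ∀ᶠ k : ℕ in atTop, (1 : ℝ) / (k + 1) < y - t :=
          htend.eventually_lt_const (by linarith)
        filter_upwards [this] with k hk
        refine ⟨fun h => ?_, fun h => absurd (hle y h) (not_le.2 hy)⟩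
        linarith [(hq k).2]
    · choose q hq using fun k : ℕ =>
        exists_rat_btwn (show t - 1 / ((k : ℝ) + 1) < t by linarith [show (0:ℝ) < 1 / ((k : ℝ) + 1) by positivity])
      refine ⟨q, fun y => ?_⟩
      rcases lt_or_ge y t with hy | hy
      · have : ∀ᶠ k : ℕ in atTop, (1 : ℝ) / (k + 1) < t - y :=
          htend.eventually_lt_const (by linarith)
        filter_upwards [this] with k hk
        exact ⟨fun _ => hlt y hy, fun _ => by linarith [(hq k).1]⟩
      · filter_upwards with k
        refine ⟨fun h => absurd (h.trans_lt (hq k).2) (not_lt.2 hy), fun h => ?_⟩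
        exact absurd (le_antisymm (hle y h) hy ▸ h) htA
  · refine ⟨fun k => (k : ℚ), fun y => ?_⟩
    have hyA : y ∈ A := by
      rw [not_bddAbove_iff] at hb
      obtain ⟨z, hz, hyz⟩ := hb y
      exact hA hyz.le hz
    obtain ⟨N, hN⟩ := exists_nat_gt y
    filter_upwards [eventually_ge_atTop N] with k hk
    have : (N : ℝ) ≤ k := by exact_mod_cast hk
    exact ⟨fun _ => hyA, fun _ => by push_cast; linarith⟩

section

variable {ν : Measure ℝ} {ψ : ℝ → ℝ} {n : ℕ} {x : Fin n → ℝ} {D : ℝ}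

theorem abs_meanDev_lowerSet_le (hψ : Integrable ψ ν)
    (hD : ∀ q : ℚ, |meanDev ν x (truncBelow ψ q)| ≤ D) {A : Set ℝ} (hA : IsLowerSet A) :
    |meanDev ν x (A.indicator ψ)| ≤ D := by
  obtain ⟨q, hq⟩ := exists_rat_seq_of_isLowerSet hA
  have hev : ∀ y, ∀ᶠ k in atTop, truncBelow ψ (q k) y = A.indicator ψ y := by
    intro y
    filter_upwards [hq y] with k hk
    by_cases hy : y ∈ A
    · rw [truncBelow, if_pos (hk.2 hy), indicator_of_mem hy]
    · rw [truncBelow, if_neg (fun h => hy (hk.1 h)), indicator_of_notMem hy]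
  have h1 : Tendsto (fun k => sampleMean x (truncBelow ψ (q k))) atTop
      (𝓝 (sampleMean x (A.indicator ψ))) :=
    (tendsto_finsetSum _ fun i _ => tendsto_nhds_of_eventually_eq (hev (x i))).const_mul _
  have h2 : Tendsto (fun k => ∫ y, truncBelow ψ (q k) y ∂ν) atTop
      (𝓝 (∫ y, A.indicator ψ y ∂ν)) := by
    refine tendsto_integral_of_dominated_convergence (fun y => ‖ψ y‖)
      (fun k => (integrable_truncBelow hψ _).aestronglyMeasurable) hψ.norm
      (fun k => Eventually.of_forall fun y => ?_)
      (Eventually.of_forall fun y => tendsto_nhds_of_eventually_eq (hev y))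
    simp only [truncBelow]; split_ifs
    · exact le_rfl
    · simp
  exact le_of_tendsto (h1.sub h2).abs (Eventually.of_forall fun k => hD (q k))

theorem abs_meanDev_ordConnected_le (hψ : Integrable ψ ν)
    (hD : ∀ q : ℚ, |meanDev ν x (truncBelow ψ q)| ≤ D) {I : Set ℝ} (hI : I.OrdConnected) :
    |meanDev ν x (I.indicator ψ)| ≤ 2 * D := by
  set A : Set ℝ := (lowerClosure I : Set ℝ) with hA
  have hAl : IsLowerSet A := (lowerClosure I).lower
  have hIA : I ⊆ A := subset_lowerClosure
  have hBl : IsLowerSet (A \ I) := by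
    rintro y z hzy ⟨hy, hyI⟩
    refine ⟨hAl hzy hy, fun hzI => hyI ?_⟩
    obtain ⟨w, hw, hyw⟩ := mem_lowerClosure.1 hy
    exact hI.out hzI hw ⟨hzy, hyw⟩
  have heq : I.indicator ψ = fun y => A.indicator ψ y - (A \ I).indicator ψ y := by
    ext y
    by_cases h1 : y ∈ I
    · simp [h1, hIA h1]
    · by_cases h2 : y ∈ A <;> simp [h1, h2]
  rw [heq, meanDev_sub x (hψ.indicator hAl.ordConnected.measurableSet)
    (hψ.indicator hBl.ordConnected.measurableSet)]
  have e1 := abs_le.1 (abs_meanDev_lowerSet_le hψ hD hAl)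
  have e2 := abs_le.1 (abs_meanDev_lowerSet_le hψ hD hBl)
  rw [abs_le]
  constructor <;> linarith [e1.1, e1.2, e2.1, e2.2]

theorem sum_step_eq {h v : ℝ} (hh : 0 < h) (N : ℕ) :
    ∑ k ∈ Finset.range N, (if ((k : ℝ) + 1) * h ≤ v then h else 0)
      = h * (min N ⌊v / h⌋₊ : ℕ) := by
  induction N with
  | zero => simp
  | succ N ih =>
    rw [Finset.sum_range_succ, ih]
    have hiff : ((N : ℝ) + 1) * h ≤ v ↔ N + 1 ≤ ⌊v / h⌋₊ := by
      rw [Nat.le_floor_iff' (by omega), le_div_iff₀ hh]; push_cast; rfl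
    by_cases hc : N + 1 ≤ ⌊v / h⌋₊
    · rw [if_pos (hiff.2 hc), min_eq_left hc, min_eq_left (by omega)]; push_cast; ring
    · rw [if_neg (fun h' => hc (hiff.1 h')), min_eq_right (by omega), min_eq_right (by omega)]
      ring

theorem abs_sub_sum_step_le {h v : ℝ} (hh : 0 < h) {N : ℕ} (hv0 : 0 ≤ v) (hv : v ≤ N * h) :
    |v - ∑ k ∈ Finset.range N, (if ((k : ℝ) + 1) * h ≤ v then h else 0)| ≤ h := by
  have hle : ⌊v / h⌋₊ ≤ N := by
    refine Nat.floor_le_of_le ?_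
    rwa [div_le_iff₀ hh]
  rw [sum_step_eq hh, min_eq_right hle]
  have h1 := Nat.floor_le (div_nonneg hv0 hh.le)
  have h2 := Nat.lt_floor_add_one (v / h)
  rw [le_div_iff₀ hh] at h1
  rw [div_lt_iff₀ hh] at h2
  rw [abs_le]
  constructor <;> nlinarith

theorem measurable_indicator_of_ordConnected {J : Set ℝ} {f : ℝ → ℝ}
    (hf0 : ∀ y ∈ J, 0 ≤ f y) (hf : ∀ u, {y | y ∈ J ∧ u ≤ f y}.OrdConnected) :
    Measurable (J.indicator f) := by
  refine measurable_of_Ici fun u => ?_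
  rcases le_or_gt u 0 with hu | hu
  · convert MeasurableSet.univ
    ext y
    simp only [mem_preimage, mem_Ici, mem_univ, iff_true]
    by_cases hy : y ∈ J
    · rw [indicator_of_mem hy]; exact hu.trans (hf0 y hy)
    · rw [indicator_of_notMem hy]; exact hu
  · convert (hf u).measurableSet
    ext y
    simp only [mem_preimage, mem_Ici, mem_ofPred_eq]
    by_cases hy : y ∈ J
    · simp [hy]
    · simp [hy, hu]

theorem integrable_mul_of_ordConnected (hψ : Integrable ψ ν) {J : Set ℝ} (hJ : ∀ᵐ y ∂ν, y ∈ J)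
    {M : ℝ} {f : ℝ → ℝ} (hfM : ∀ y ∈ J, 0 ≤ f y ∧ f y ≤ M)
    (hf : ∀ u, {y | y ∈ J ∧ u ≤ f y}.OrdConnected) : Integrable (fun y => ψ y * f y) ν := by
  have hm := measurable_indicator_of_ordConnected (fun y hy => (hfM y hy).1) hf
  have h1 : Integrable (fun y => J.indicator f y * ψ y) ν := by
    refine hψ.bdd_mul (c := |M|) hm.aestronglyMeasurable ?_
    filter_upwards [hJ] with y hy
    rw [indicator_of_mem hy, Real.norm_eq_abs]
    exact abs_le_abs_of_nonneg (hfM y hy).1 (hfM y hy).2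
  refine h1.congr ?_
  filter_upwards [hJ] with y hy
  rw [indicator_of_mem hy, mul_comm]

theorem abs_meanDev_mul_le (hψ : Integrable ψ ν)
    (hD : ∀ q : ℚ, |meanDev ν x (truncBelow ψ q)| ≤ D) {J : Set ℝ} (hJ : ∀ᵐ y ∂ν, y ∈ J)
    (hx : ∀ i, x i ∈ J) {M : ℝ} (hM : 0 < M) {f : ℝ → ℝ} (hfM : ∀ y ∈ J, 0 ≤ f y ∧ f y ≤ M)
    (hf : ∀ u, {y | y ∈ J ∧ u ≤ f y}.OrdConnected) :
    |meanDev ν x (fun y => ψ y * f y)| ≤ 2 * M * D := by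
  have hint := integrable_mul_of_ordConnected hψ hJ hfM hf
  set c := sampleMean x (fun y => |ψ y|) + ∫ y, |ψ y| ∂ν with hc
  have key : ∀ N : ℕ, |meanDev ν x (fun y => ψ y * f y)| ≤ 2 * M * D + M / ((N : ℝ) + 1) * c := by
    intro N
    set h := M / ((N : ℝ) + 1) with hh
    have hpos : 0 < h := by positivity
    have hNh : ((N + 1 : ℕ) : ℝ) * h = M := by rw [hh]; push_cast; field_simp
    set I : ℕ → Set ℝ := fun k => {y | y ∈ J ∧ ((k : ℝ) + 1) * h ≤ f y} with hI
    set F : ℝ → ℝ := fun y => ∑ k ∈ Finset.range (N + 1), h * (I k).indicator ψ y with hF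
    have hFint : Integrable F ν := integrable_finsetSum _ fun k _ =>
      (hψ.indicator (hf _).measurableSet).const_mul h
    have hFeq : ∀ y ∈ J, F y = ψ y *
        ∑ k ∈ Finset.range (N + 1), (if ((k : ℝ) + 1) * h ≤ f y then h else 0) := by
      intro y hy
      rw [hF, Finset.mul_sum]
      refine Finset.sum_congr rfl fun k _ => ?_
      by_cases hk : ((k : ℝ) + 1) * h ≤ f y
      · rw [if_pos hk, indicator_of_mem (show y ∈ I k from ⟨hy, hk⟩), mul_comm]
      · rw [if_neg hk, indicator_of_notMem (fun h' : y ∈ I k => hk h'.2)]; simp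
    have hdiff : ∀ y ∈ J, |ψ y * f y - F y| ≤ h * |ψ y| := by
      intro y hy
      rw [hFeq y hy, ← mul_sub, abs_mul, mul_comm]
      refine mul_le_mul_of_nonneg_right ?_ (abs_nonneg _)
      exact abs_sub_sum_step_le hpos (hfM y hy).1 (by rw [hNh]; exact (hfM y hy).2)
    have h1 : |meanDev ν x F| ≤ 2 * M * D := by
      rw [hF, meanDev_sum x _ fun k _ => (hψ.indicator (hf _).measurableSet).const_mul h]
      refine (Finset.abs_sum_le_sum_abs _ _).trans ?_
      have : ∀ k ∈ Finset.range (N + 1),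
          |meanDev ν x fun y => h * (I k).indicator ψ y| ≤ h * (2 * D) := by
        intro k _
        rw [meanDev_const_mul, abs_mul, abs_of_pos hpos]
        exact mul_le_mul_of_nonneg_left (abs_meanDev_ordConnected_le hψ hD (hf _)) hpos.le
      refine (Finset.sum_le_sum this).trans ?_
      rw [Finset.sum_const, Finset.card_range, nsmul_eq_mul, ← mul_assoc, hNh]
      apply le_of_eq; ring
    have h2 : |meanDev ν x (fun y => ψ y * f y - F y)| ≤ h * c := by
      rw [meanDev]
      have e1 : |sampleMean x (fun y => ψ y * f y - F y)| ≤ h * sampleMean x (fun y => |ψ y|) := by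
        rw [← sampleMean_const_mul]
        exact abs_sampleMean_le x fun i => hdiff _ (hx i)
      have e2 : |∫ y, (ψ y * f y - F y) ∂ν| ≤ h * ∫ y, |ψ y| ∂ν := by
        rw [← integral_const_mul, ← Real.norm_eq_abs]
        refine norm_integral_le_of_norm_le (hψ.abs.const_mul h) ?_
        filter_upwards [hJ] with y hy using hdiff y hy
      rw [hc, mul_add]
      exact (abs_sub _ _).trans (add_le_add e1 e2)
    rw [meanDev_sub x hint hFint] at h2
    have := abs_sub_abs_le_abs_sub (meanDev ν x fun y => ψ y * f y) (meanDev ν x F)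
    linarith
  have hlim : Tendsto (fun N : ℕ => 2 * M * D + M / ((N : ℝ) + 1) * c) atTop
      (𝓝 (2 * M * D + 0 * c)) := by
    refine tendsto_const_nhds.add (Tendsto.mul_const _ ?_)
    have := (tendsto_one_div_add_atTop_nhds_zero_nat (𝕜 := ℝ)).const_mul M
    simpa [div_eq_mul_inv] using this
  have := ge_of_tendsto' hlim key
  simpa using this

end

theorem ordConnected_levels_of_mem_shapeClass {a b c M : ℝ} {s : Shape} {f : ℝ → ℝ}
    (hf : f ∈ shapeClass a b c M s) :
    (∀ u, {y | y ∈ Icc a b ∧ u ≤ f y}.OrdConnected) ∨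
      (∀ u, {y | y ∈ Icc a b ∧ u ≤ M - f y}.OrdConnected) := by
  obtain ⟨-, hs⟩ := hf
  cases s with
  | monotonicity =>
    refine Or.inl fun u => ⟨fun y hy z hz w hw => ?_⟩
    have hwJ : w ∈ Icc a b := ⟨hy.1.1.trans hw.1, hw.2.trans hz.1.2⟩
    exact ⟨hwJ, hz.2.trans (hs hwJ hz.1 hw.2)⟩
  | convexity =>
    refine Or.inr fun u => ?_
    have := (ConvexOn.convex_le hs (M - u)).ordConnected
    refine (congrArg OrdConnected (Set.ext fun y => ?_)).mpr this
    exact and_congr_right fun _ => ⟨fun h => by linarith, fun h => by linarith⟩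
  | unimodality =>
    refine Or.inl fun u => ⟨fun y hy z hz w hw => ?_⟩
    have hwJ : w ∈ Icc a b := ⟨hy.1.1.trans hw.1, hw.2.trans hz.1.2⟩
    refine ⟨hwJ, ?_⟩
    rcases le_total w c with h | h
    · exact hy.2.trans (hs.1 ⟨hy.1.1, hw.1.trans h⟩ ⟨hwJ.1, h⟩ hw.1)
    · exact hz.2.trans (hs.2 ⟨h, hwJ.2⟩ ⟨h.trans hw.2, hz.1.2⟩ hw.2)

section

variable {ν : Measure ℝ} {ψ : ℝ → ℝ} {n : ℕ} {x : Fin n → ℝ} {D : ℝ}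

theorem integrable_mul_of_mem_shapeClass (hψ : Integrable ψ ν) {a b c M : ℝ} {s : Shape}
    (hJ : ∀ᵐ y ∂ν, y ∈ Icc a b) {f : ℝ → ℝ} (hf : f ∈ shapeClass a b c M s) :
    Integrable (fun y => ψ y * f y) ν := by
  rcases ordConnected_levels_of_mem_shapeClass hf with h | h
  · exact integrable_mul_of_ordConnected hψ hJ hf.1 h
  · have := integrable_mul_of_ordConnected (M := M) hψ hJ
      (fun y hy => ⟨by linarith [(hf.1 y hy).2], by linarith [(hf.1 y hy).1]⟩) h
    refine ((hψ.mul_const M).sub this).congr (Eventually.of_forall fun y => ?_)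
    simp only [Pi.sub_apply]; ring

theorem abs_meanDev_shapeClass_le (hψ : Integrable ψ ν)
    (hD : ∀ q : ℚ, |meanDev ν x (truncBelow ψ q)| ≤ D) {a b c M : ℝ} (hM : 0 < M) {s : Shape}
    (hJ : ∀ᵐ y ∂ν, y ∈ Icc a b) (hx : ∀ i, x i ∈ Icc a b) {f : ℝ → ℝ}
    (hf : f ∈ shapeClass a b c M s) :
    |meanDev ν x (fun y => ψ y * f y)| ≤ 3 * M * D := by
  have hD0 : 0 ≤ D := (abs_nonneg _).trans (hD 0)
  rcases ordConnected_levels_of_mem_shapeClass hf with h | h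
  · exact (abs_meanDev_mul_le hψ hD hJ hx hM hf.1 h).trans (by nlinarith)
  · have hb : ∀ y ∈ Icc a b, 0 ≤ M - f y ∧ M - f y ≤ M := fun y hy =>
      ⟨by linarith [(hf.1 y hy).2], by linarith [(hf.1 y hy).1]⟩
    have h1 := abs_meanDev_mul_le hψ hD hJ hx hM hb h
    have h2 : |meanDev ν x (fun y => M * ψ y)| ≤ M * D := by
      rw [meanDev_const_mul, abs_mul, abs_of_pos hM]
      refine mul_le_mul_of_nonneg_left ?_ hM.le
      have := abs_meanDev_lowerSet_le hψ hD isLowerSet_univ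
      rwa [indicator_univ] at this
    have h3 := integrable_mul_of_ordConnected hψ hJ hb h
    have heq : (fun y => ψ y * f y) = fun y => M * ψ y - ψ y * (M - f y) := by
      ext y; ring
    rw [heq, meanDev_sub x (hψ.const_mul M) h3]
    exact (abs_sub _ _).trans (by linarith)

end

/-! ### Stability of convex programs under the Slater condition -/

section Stability

variable {V : Type*} [AddCommGroup V] [Module ℝ V] {m q : ℕ}

/-- `F` is affine along segments of `C`. -/
def IsAffineOn (C : Set V) (F : V → ℝ) : Prop :=
  ∀ x ∈ C, ∀ y ∈ C, ∀ t : ℝ, 0 ≤ t → t ≤ 1 → F ((1 - t) • x + t • y) = (1 - t) * F x + t * F y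

/-- A quantitative Slater condition: all small perturbations of the equality constraints are
attained with slack `s` in the inequality constraints. -/
def UniformSlater (C : Set V) (A : Fin m ⊕ Fin q → V → ℝ) (μ : Fin m ⊕ Fin q → ℝ)
    (r s : ℝ) : Prop :=
  ∀ v : Fin q → ℝ, (∀ j, |v j| ≤ r) →
    ∃ L ∈ C, (∀ i, A (.inl i) L ≤ μ (.inl i) - s) ∧ ∀ j, A (.inr j) L = μ (.inr j) + v j

theorem UniformSlater.mono {W : Type*} {C : Set W} {A : Fin m ⊕ Fin q → W → ℝ} {μ : Fin m ⊕ Fin q → ℝ}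
    {r s r' s' : ℝ} (h : UniformSlater C A μ r s) (hr : r' ≤ r) (hs : s' ≤ s) :
    UniformSlater C A μ r' s' := by
  intro v hv
  obtain ⟨L, hL, h1, h2⟩ := h v fun j => (hv j).trans hr
  exact ⟨L, hL, fun i => (h1 i).trans (by linarith), h2⟩

theorem combo_mem {C : Set V} (hC : Convex ℝ C) {x y : V} (hx : x ∈ C) (hy : y ∈ C) {t : ℝ}
    (h0 : 0 ≤ t) (h1 : t ≤ 1) : (1 - t) • x + t • y ∈ C :=
  hC hx hy (by linarith) h0 (by ring)

theorem exists_pos_le_of_finite {ι : Type*} [Finite ι] {f : ι → ℝ} (hf : ∀ i, 0 < f i) :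
    ∃ s, 0 < s ∧ ∀ i, s ≤ f i := by
  rcases isEmpty_or_nonempty ι with h | h
  · exact ⟨1, one_pos, fun i => (h.false i).elim⟩
  · obtain ⟨i, hi⟩ := Finite.exists_min f
    exact ⟨f i, hf i, hi⟩

theorem exists_uniformSlater {C : Set V} (hC : Convex ℝ C) {A : Fin m ⊕ Fin q → V → ℝ}
    {μ : Fin m ⊕ Fin q → ℝ} (hA : ∀ j, IsAffineOn C (A j)) {B : ℝ}
    (hB : ∀ j, ∀ L ∈ C, |A j L| ≤ B)
    (hL₀ : ∃ L₀ ∈ C, (∀ i, A (.inl i) L₀ < μ (.inl i)) ∧ ∀ j, A (.inr j) L₀ = μ (.inr j))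
    (hint : (fun j : Fin q => μ (.inr j)) ∈
      interior {v : Fin q → ℝ | ∃ L ∈ C, v = fun j => A (.inr j) L}) :
    ∃ r s, 0 < r ∧ 0 < s ∧ UniformSlater C A μ r s := by
  obtain ⟨L₀, hL₀C, hineq, heq⟩ := hL₀
  obtain ⟨s₀, hs₀, hs₀le⟩ := exists_pos_le_of_finite (f := fun i => μ (.inl i) - A (.inl i) L₀)
    fun i => sub_pos.2 (hineq i)
  obtain ⟨r₀, hr₀, hball⟩ := Metric.mem_nhds_iff.1 (mem_interior_iff_mem_nhds.1 hint)
  set b := max B 0 with hb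
  have hb0 : 0 ≤ b := le_max_right _ _
  have hBb : ∀ j, ∀ L ∈ C, |A j L| ≤ b := fun j L hL => (hB j L hL).trans (le_max_left _ _)
  set θ := s₀ / (2 * (2 * b + s₀)) with hθ
  have hden : 0 < 2 * (2 * b + s₀) := by positivity
  have hθ0 : 0 < θ := by positivity
  have hθ1 : θ ≤ 1 := by rw [hθ, div_le_one hden]; linarith
  refine ⟨θ * (r₀ / 2), s₀ / 2, by positivity, by positivity, fun v hv => ?_⟩
  have hmem : (fun j => μ (.inr j) + v j / θ) ∈ Metric.ball (fun j : Fin q => μ (.inr j)) r₀ := by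
    rw [mem_ball_iff_norm]
    refine lt_of_le_of_lt ((pi_norm_le_iff_of_nonneg (by positivity : 0 ≤ r₀ / 2)).2 fun j => ?_)
      (half_lt_self hr₀)
    rw [Pi.sub_apply, add_sub_cancel_left, Real.norm_eq_abs, abs_div, abs_of_pos hθ0,
      div_le_iff₀ hθ0, mul_comm]
    exact hv j
  obtain ⟨L₁, hL₁, hL₁eq⟩ := hball hmem
  refine ⟨(1 - θ) • L₀ + θ • L₁, combo_mem hC hL₀C hL₁ hθ0.le hθ1, fun i => ?_, fun j => ?_⟩
  · rw [hA _ _ hL₀C _ hL₁ _ hθ0.le hθ1]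
    have h1 := (abs_le.1 (hBb (.inl i) L₀ hL₀C)).1
    have h2 := (abs_le.1 (hBb (.inl i) L₁ hL₁)).2
    have h3 := hs₀le i
    have h4 : θ * (2 * b + s₀) = s₀ / 2 := by
      rw [hθ]; field_simp
    have h5 := mul_le_mul_of_nonneg_left h3 (by linarith : 0 ≤ 1 - θ)
    have h6 : θ * (A (.inl i) L₁ - μ (.inl i) + s₀) ≤ θ * (2 * b + s₀) :=
      mul_le_mul_of_nonneg_left (by linarith) hθ0.le
    nlinarith
  · rw [hA _ _ hL₀C _ hL₁ _ hθ0.le hθ1, heq j, ← congrFun hL₁eq j]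
    field_simp
    ring

theorem mem_convexHull_of_sign_vertices {w₀ w : Fin q → ℝ} {r D : ℝ}
    (p : (Fin q → Bool) → Fin q → ℝ)
    (hp : ∀ σ j, |p σ j - (w₀ j + r * boolSign (σ j))| ≤ D)
    (hw : ∀ j, |w j - w₀ j| ≤ r - D) : w ∈ convexHull ℝ (range p) := by
  classical
  by_contra hnot
  obtain ⟨l, u, hl, hlw⟩ := geometric_hahn_banach_closed_point (convex_convexHull ℝ (range p))
    ((finite_range p).isCompact_convexHull ℝ).isClosed hnot
  have hrep : ∀ z : Fin q → ℝ, l z = ∑ j, z j * l (Pi.single j 1) := by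
    intro z
    conv_lhs => rw [← Finset.univ_sum_single z]
    rw [map_sum]
    refine Finset.sum_congr rfl fun j _ => ?_
    rw [show Pi.single j (z j) = z j • (Pi.single j (1 : ℝ) : Fin q → ℝ) by
      rw [← Pi.single_smul, smul_eq_mul, mul_one], map_smul, smul_eq_mul]
  set σ : Fin q → Bool := fun j => decide (0 ≤ l (Pi.single j 1)) with hσ
  have hlt : l (p σ) < l w := (hl _ (subset_convexHull ℝ _ (mem_range_self σ))).trans hlw
  refine absurd hlt (not_lt.2 ?_)
  rw [hrep, hrep (p σ)]
  refine Finset.sum_le_sum fun j _ => ?_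
  have h1 := abs_le.1 (hp σ j)
  have h2 := abs_le.1 (hw j)
  by_cases h : 0 ≤ l (Pi.single j 1)
  · have hs : boolSign (σ j) = 1 := by simp [hσ, boolSign, h]
    rw [hs] at h1
    exact mul_le_mul_of_nonneg_right (by linarith) h
  · have hs : boolSign (σ j) = -1 := by simp [hσ, boolSign, h]
    rw [hs] at h1
    exact mul_le_mul_of_nonpos_right (by linarith) (not_le.1 h).le

theorem UniformSlater.perturb {C : Set V} (hC : Convex ℝ C) {A A' : Fin m ⊕ Fin q → V → ℝ}
    {μ : Fin m ⊕ Fin q → ℝ} (hA : ∀ j, IsAffineOn C (A j)) (hA' : ∀ j, IsAffineOn C (A' j))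
    {r s D : ℝ} (hr : 0 ≤ r) (h : UniformSlater C A μ r s)
    (hD : ∀ j, ∀ L ∈ C, |A' j L - A j L| ≤ D) :
    UniformSlater C A' μ (r - D) (s - D) := by
  intro v hv
  have habs : ∀ b, |boolSign b| = 1 := by intro b; cases b <;> simp [boolSign]
  choose L hLC hLi hLe using fun σ : Fin q → Bool => h (fun j => r * boolSign (σ j))
    fun j => by rw [abs_mul, habs, mul_one, abs_of_nonneg hr]
  set S : Set (Fin q → ℝ) := {z | ∃ L ∈ C, (∀ i, A (.inl i) L ≤ μ (.inl i) - s) ∧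
    ∀ j, z j = A' (.inr j) L} with hS
  have hSconv : Convex ℝ S := by
    rintro z ⟨L₁, h1, h1i, h1e⟩ z' ⟨L₂, h2, h2i, h2e⟩ α t hα ht hsum
    obtain rfl : α = 1 - t := by linarith
    have ht1 : t ≤ 1 := by linarith
    refine ⟨(1 - t) • L₁ + t • L₂, combo_mem hC h1 h2 ht ht1, fun i => ?_, fun j => ?_⟩
    · rw [hA _ _ h1 _ h2 _ ht ht1]
      have := mul_le_mul_of_nonneg_left (h1i i) hα
      have := mul_le_mul_of_nonneg_left (h2i i) ht
      nlinarith
    · rw [hA' _ _ h1 _ h2 _ ht ht1, ← h1e, ← h2e]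
      simp
  have hmem : (fun j => μ (.inr j) + v j) ∈ convexHull ℝ
      (range fun (σ : Fin q → Bool) j => A' (.inr j) (L σ)) := by
    refine mem_convexHull_of_sign_vertices (w₀ := fun j => μ (.inr j)) (r := r) (D := D) _
      (fun σ j => ?_) fun j => ?_
    · rw [← hLe σ j]; exact hD _ _ (hLC σ)
    · rw [add_sub_cancel_left]; exact hv j
  have hsub : convexHull ℝ (range fun (σ : Fin q → Bool) j => A' (.inr j) (L σ)) ⊆ S := by
    refine convexHull_min ?_ hSconv
    rintro _ ⟨σ, rfl⟩
    exact ⟨L σ, hLC σ, hLi σ, fun _ => rfl⟩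
  obtain ⟨L', hL', hi, he⟩ := hsub hmem
  refine ⟨L', hL', fun i => ?_, fun j => (he j).symm⟩
  linarith [hi i, (abs_le.1 (hD (.inl i) L' hL')).2]

/-- Repair of an approximately feasible point at a proportional loss in the objective. -/
theorem UniformSlater.repair {C : Set V} (hC : Convex ℝ C) {A₀ : V → ℝ}
    {A : Fin m ⊕ Fin q → V → ℝ} {μ : Fin m ⊕ Fin q → ℝ} (hA₀ : IsAffineOn C A₀)
    (hA : ∀ j, IsAffineOn C (A j)) {r s B D K : ℝ} (hr : 0 < r)
    (h : UniformSlater C A μ r s) (hB : ∀ L ∈ C, |A₀ L| ≤ B) (hD : 0 ≤ D)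
    (hKr : 1 ≤ K * r) (hKs : 1 ≤ K * s) (hDK : D * K ≤ 1) {L : V} (hL : L ∈ C)
    (hi : ∀ i, A (.inl i) L ≤ μ (.inl i) + D) (he : ∀ j, |A (.inr j) L - μ (.inr j)| ≤ D) :
    ∃ L' ∈ C, (∀ i, A (.inl i) L' ≤ μ (.inl i)) ∧ (∀ j, A (.inr j) L' = μ (.inr j)) ∧
      A₀ L - 2 * B * (D * K) ≤ A₀ L' := by
  rcases hD.eq_or_lt with rfl | hD
  · refine ⟨L, hL, fun i => by linarith [hi i], fun j => ?_, by simp⟩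
    have := abs_nonpos_iff.1 (he j)
    linarith
  have hK : 0 < K := by
    by_contra hneg
    have := mul_nonpos_of_nonpos_of_nonneg (not_lt.1 hneg) hr.le
    linarith
  set t := D * K with ht
  have ht0 : 0 < t := by positivity
  obtain ⟨L₁, hL₁, h1, h2⟩ := h (fun j => -((1 - t) * (A (.inr j) L - μ (.inr j)) / t)) (by
    intro j
    rw [abs_neg, abs_div, abs_mul, abs_of_nonneg (by linarith : 0 ≤ 1 - t), abs_of_pos ht0,
      div_le_iff₀ ht0]
    have h3 : (1 - t) * |A (.inr j) L - μ (.inr j)| ≤ 1 * D :=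
      mul_le_mul (by linarith) (he j) (abs_nonneg _) (by norm_num)
    have h4 : r * t = D * (K * r) := by rw [ht]; ring
    nlinarith)
  refine ⟨(1 - t) • L + t • L₁, combo_mem hC hL hL₁ ht0.le hDK, fun i => ?_, fun j => ?_, ?_⟩
  · rw [hA _ _ hL _ hL₁ _ ht0.le hDK]
    have h3 := mul_le_mul_of_nonneg_left (hi i) (by linarith : 0 ≤ 1 - t)
    have h4 := mul_le_mul_of_nonneg_left (h1 i) ht0.le
    have h5 : t * s = D * (K * s) := by rw [ht]; ring
    nlinarith
  · rw [hA _ _ hL _ hL₁ _ ht0.le hDK, h2 j]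
    field_simp
    ring
  · rw [hA₀ _ hL _ hL₁ _ ht0.le hDK]
    have h3 := abs_le.1 (hB L hL)
    have h4 := abs_le.1 (hB L₁ hL₁)
    nlinarith

end Stability

theorem iSup_coe_ereal_eq {α : Type*} {S : Set α} (hS : S.Nonempty) {F : α → ℝ} {B : ℝ}
    (hB : ∀ x ∈ S, F x ≤ B) :
    ⨆ x ∈ S, (F x : EReal) = ((sSup (F '' S) : ℝ) : EReal) := by
  have hbdd : BddAbove (F '' S) := ⟨B, by rintro _ ⟨x, hx, rfl⟩; exact hB x hx⟩
  refine le_antisymm (iSup₂_le fun x hx => ?_) ?_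
  · exact EReal.coe_le_coe_iff.2 (le_csSup hbdd (mem_image_of_mem F hx))
  · have hle : ∀ x ∈ S, (F x : EReal) ≤ ⨆ x ∈ S, (F x : EReal) := fun x hx =>
      le_iSup₂ (f := fun x (_ : x ∈ S) => (F x : EReal)) x hx
    have htop : (⨆ x ∈ S, (F x : EReal)) ≤ (B : EReal) :=
      iSup₂_le fun x hx => EReal.coe_le_coe_iff.2 (hB x hx)
    obtain ⟨x₀, hx₀⟩ := hS
    have hbot : (⨆ x ∈ S, (F x : EReal)) ≠ ⊥ := ne_bot_of_le_ne_bot (EReal.coe_ne_bot _) (hle x₀ hx₀)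
    have htop' : (⨆ x ∈ S, (F x : EReal)) ≠ ⊤ := ne_top_of_le_ne_top (EReal.coe_ne_top _) htop
    lift (⨆ x ∈ S, (F x : EReal)) to ℝ using ⟨htop', hbot⟩ with y
    refine EReal.coe_le_coe_iff.2 (csSup_le (Set.Nonempty.image _ ⟨x₀, hx₀⟩) ?_)
    rintro _ ⟨x, hx, rfl⟩
    exact EReal.coe_le_coe_iff.1 (hle x hx)

/-- Lipschitz stability of the optimal value of a convex program satisfying the Slater condition,
with respect to uniform perturbations of the moment functional. -/
theorem exists_value_stability {m q : ℕ} {E : (ℝ → ℝ) → ℝ} {C : Set (ℝ → ℝ)} (hC : Convex ℝ C)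
    {φ₀ : ℝ → ℝ} {φ : Fin m ⊕ Fin q → ℝ → ℝ} {μ : Fin m ⊕ Fin q → ℝ}
    (hE₀ : IsAffineOn C fun L => E fun x => φ₀ x * L x)
    (hE : ∀ j, IsAffineOn C fun L => E fun x => φ j x * L x) {B : ℝ}
    (hB₀ : ∀ L ∈ C, |E fun x => φ₀ x * L x| ≤ B) (hB : ∀ j, ∀ L ∈ C, |E fun x => φ j x * L x| ≤ B)
    (hSlater : SlaterCondition E C φ μ) :
    ∃ v : ℝ, value E C φ₀ φ μ = v ∧ ∃ K ε₀ : ℝ, 0 < K ∧ 0 < ε₀ ∧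
      ∀ (E' : (ℝ → ℝ) → ℝ) (D : ℝ), 0 ≤ D → D ≤ ε₀ →
        (IsAffineOn C fun L => E' fun x => φ₀ x * L x) →
        (∀ j, IsAffineOn C fun L => E' fun x => φ j x * L x) →
        (∀ L ∈ C, |(E' fun x => φ₀ x * L x) - E fun x => φ₀ x * L x| ≤ D) →
        (∀ j, ∀ L ∈ C, |(E' fun x => φ j x * L x) - E fun x => φ j x * L x| ≤ D) →
        ∃ v' : ℝ, value E' C φ₀ φ μ = v' ∧ |v' - v| ≤ K * D := by
  obtain ⟨r, s, hr, hs, hU⟩ := exists_uniformSlater hC hE hB hSlater.1 hSlater.2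
  obtain ⟨L₀, hL₀C, hL₀i, hL₀e⟩ := hSlater.1
  have hB0 : 0 ≤ B := (abs_nonneg _).trans (hB₀ L₀ hL₀C)
  have hne : (feasible E C φ μ).Nonempty := ⟨L₀, fun i => (hL₀i i).le, hL₀e, hL₀C⟩
  have hval := iSup_coe_ereal_eq hne (F := fun L => E fun x => φ₀ x * L x) (B := B)
    fun L hL => (abs_le.1 (hB₀ L hL.2.2)).2
  set v := sSup ((fun L => E fun x => φ₀ x * L x) '' feasible E C φ μ) with hv
  refine ⟨v, hval, ?_⟩
  set κ := 2 / r + 2 / s with hκ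
  have hκ0 : 0 < κ := by positivity
  have hκr : 1 ≤ κ * (r / 2) := by
    have : κ * (r / 2) = 1 + r / s := by rw [hκ]; field_simp
    rw [this]; linarith [div_pos hr hs]
  have hκs : 1 ≤ κ * (s / 2) := by
    have : κ * (s / 2) = 1 + s / r := by rw [hκ]; field_simp; ring
    rw [this]; linarith [div_pos hs hr]
  set ε₀ := min (min (r / 2) (s / 2)) (min (1 / κ) 1) with hε₀
  refine ⟨2 * (B + 1) * κ + 1, ε₀, by positivity, by positivity, ?_⟩
  intro E' D hD0 hD hE'₀ hE' hd₀ hd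
  have hDr : D ≤ r / 2 := hD.trans ((min_le_left _ _).trans (min_le_left _ _))
  have hDs : D ≤ s / 2 := hD.trans ((min_le_left _ _).trans (min_le_right _ _))
  have hDκ : D * κ ≤ 1 := by
    rw [← le_div_iff₀ hκ0]; exact hD.trans ((min_le_right _ _).trans (min_le_left _ _))
  have hD1 : D ≤ 1 := hD.trans ((min_le_right _ _).trans (min_le_right _ _))
  have hUh : UniformSlater C (fun j L => E fun x => φ j x * L x) μ (r / 2) (s / 2) :=
    hU.mono (by linarith) (by linarith)
  have hU' : UniformSlater C (fun j L => E' fun x => φ j x * L x) μ (r / 2) (s / 2) :=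
    (hU.perturb hC hE hE' hr.le hd).mono (by linarith) (by linarith)
  have hB' : ∀ L ∈ C, |E' fun x => φ₀ x * L x| ≤ B + 1 := by
    intro L hL
    have h1 := abs_le.1 (hd₀ L hL)
    have h2 := abs_le.1 (hB₀ L hL)
    rw [abs_le]; constructor <;> linarith [h1.1, h1.2, h2.1, h2.2]
  have hne' : (feasible E' C φ μ).Nonempty := by
    obtain ⟨L, hL, hi, he⟩ := hU' 0 (fun j => by simp; positivity)
    exact ⟨L, fun i => (hi i).trans (by linarith), fun j => by simpa using he j, hL⟩
  have hval' := iSup_coe_ereal_eq hne' (F := fun L => E' fun x => φ₀ x * L x) (B := B + 1)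
    fun L hL => (abs_le.1 (hB' L hL.2.2)).2
  refine ⟨_, hval', ?_⟩
  have hbdd : BddAbove ((fun L => E fun x => φ₀ x * L x) '' feasible E C φ μ) :=
    ⟨B, by rintro _ ⟨L, hL, rfl⟩; exact (abs_le.1 (hB₀ L hL.2.2)).2⟩
  have hbdd' : BddAbove ((fun L => E' fun x => φ₀ x * L x) '' feasible E' C φ μ) :=
    ⟨B + 1, by rintro _ ⟨L, hL, rfl⟩; exact (abs_le.1 (hB' L hL.2.2)).2⟩
  have hloss : 2 * B * (D * κ) + D ≤ (2 * (B + 1) * κ + 1) * D := by nlinarith [mul_nonneg hD0 hκ0.le]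
  have hup : sSup ((fun L => E' fun x => φ₀ x * L x) '' feasible E' C φ μ)
      ≤ v + (2 * (B + 1) * κ + 1) * D := by
    refine csSup_le (hne'.image _) ?_
    rintro _ ⟨L, hL, rfl⟩
    obtain ⟨L', hL', hi, he, hobj⟩ := hUh.repair hC hE₀ hE (by positivity) hB₀
      hD0 hκr hκs hDκ hL.2.2
      (fun i => by linarith [hL.1 i, (abs_le.1 (hd (.inl i) L hL.2.2)).1])
      (fun j => by have := hd (.inr j) L hL.2.2; rwa [hL.2.1 j, abs_sub_comm] at this)
    have h1 : (E fun x => φ₀ x * L' x) ≤ v := le_csSup hbdd ⟨L', ⟨hi, he, hL'⟩, rfl⟩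
    have h2 := (abs_le.1 (hd₀ L hL.2.2)).2
    dsimp only at hobj ⊢
    linarith
  have hlow : v ≤ sSup ((fun L => E' fun x => φ₀ x * L x) '' feasible E' C φ μ)
      + (2 * (B + 1) * κ + 1) * D := by
    refine csSup_le (hne.image _) ?_
    rintro _ ⟨L, hL, rfl⟩
    obtain ⟨L', hL', hi, he, hobj⟩ := hU'.repair hC hE'₀ hE' (by positivity) hB'
      hD0 hκr hκs hDκ hL.2.2
      (fun i => by linarith [hL.1 i, (abs_le.1 (hd (.inl i) L hL.2.2)).2])
      (fun j => by have := hd (.inr j) L hL.2.2; rwa [hL.2.1 j] at this)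
    have h1 := le_csSup hbdd' ⟨L', ⟨hi, he, hL'⟩, rfl⟩
    have h2 := (abs_le.1 (hd₀ L hL.2.2)).1
    dsimp only at hobj h1 ⊢
    linarith
  rw [abs_le]
  constructor <;> linarith

/-! ### Reduction to the linear program -/

theorem MonotoneOn.exists_monotone_extension_bounded {w : ℝ → ℝ} {S : Set ℝ} {M : ℝ} (hM : 0 ≤ M)
    (h : MonotoneOn w S) (hw : ∀ y ∈ S, 0 ≤ w y ∧ w y ≤ M) :
    ∃ G : ℝ → ℝ, Monotone G ∧ (∀ y, 0 ≤ G y ∧ G y ≤ M) ∧ ∀ y ∈ S, G y = w y := by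
  obtain ⟨G, hG, hGw⟩ := h.exists_monotone_extension
    ⟨0, by rintro _ ⟨y, hy, rfl⟩; exact (hw y hy).1⟩ ⟨M, by rintro _ ⟨y, hy, rfl⟩; exact (hw y hy).2⟩
  refine ⟨fun y => max 0 (min M (G y)), fun y z hyz => ?_, fun y => ?_, fun y hy => ?_⟩
  · exact max_le_max le_rfl (min_le_min le_rfl (hG hyz))
  · exact ⟨le_max_left _ _, max_le hM (min_le_left _ _)⟩
  · dsimp only
    rw [← hGw hy, min_eq_right (hw y hy).2, max_eq_right (hw y hy).1]

theorem AntitoneOn.exists_antitone_extension_bounded {w : ℝ → ℝ} {S : Set ℝ} {M : ℝ} (hM : 0 ≤ M)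
    (h : AntitoneOn w S) (hw : ∀ y ∈ S, 0 ≤ w y ∧ w y ≤ M) :
    ∃ G : ℝ → ℝ, Antitone G ∧ (∀ y, 0 ≤ G y ∧ G y ≤ M) ∧ ∀ y ∈ S, G y = w y := by
  obtain ⟨G, hG, hG01, hGw⟩ := MonotoneOn.exists_monotone_extension_bounded (w := fun y => M - w y)
    hM (fun y hy z hz hyz => by linarith [h hy hz hyz])
    (fun y hy => ⟨by linarith [(hw y hy).2], by linarith [(hw y hy).1]⟩)
  refine ⟨fun y => M - G y, fun y z hyz => by linarith [hG hyz], fun y => ?_, fun y hy => ?_⟩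
  · constructor <;> linarith [(hG01 y).1, (hG01 y).2]
  · dsimp only; rw [hGw y hy]; ring

theorem exists_bracket {X : ℕ → ℝ} {y : ℝ} (N : ℕ) (h0 : X 0 ≤ y) (h1 : y ≤ X (N + 1)) :
    ∃ k ≤ N, X k ≤ y ∧ y ≤ X (k + 1) := by
  induction N with
  | zero => exact ⟨0, le_rfl, h0, h1⟩
  | succ N ih =>
    rcases le_total y (X (N + 1)) with h | h
    · obtain ⟨k, hk, h2⟩ := ih h
      exact ⟨k, hk.trans (Nat.le_succ N), h2⟩
    · exact ⟨N + 1, le_rfl, h, h1⟩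

/-- Convex piecewise linear interpolation. -/
theorem exists_convex_interpolation {n : ℕ} {X V : ℕ → ℝ} {M : ℝ}
    (hX : ∀ i ≤ n, X i < X (i + 1))
    (hslope : ∀ i, i + 1 ≤ n → (V (i + 1) - V i) / (X (i + 1) - X i) ≤
          (V (i + 2) - V (i + 1)) / (X (i + 2) - X (i + 1)))
    (hV : ∀ i ≤ n + 1, 0 ≤ V i ∧ V i ≤ M) :
    ∃ f : ℝ → ℝ, ConvexOn ℝ univ f ∧ (∀ y ∈ Icc (X 0) (X (n + 1)), 0 ≤ f y ∧ f y ≤ M) ∧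
      ∀ i ≤ n + 1, f (X i) = V i := by
  set s : ℕ → ℝ := fun k => (V (k + 1) - V k) / (X (k + 1) - X k) with hs
  set l : ℕ → ℝ → ℝ := fun k y => V k + s k * (y - X k) with hl
  have hXmono : ∀ i j, i ≤ j → j ≤ n + 1 → X i ≤ X j := by
    intro i j hij
    induction j, hij using Nat.le_induction with
    | base => intro _; exact le_rfl
    | succ j _ ih => intro hj; exact (ih (by omega)).trans (hX j (by omega)).le
  have hstep : ∀ k ≤ n, s k * (X (k + 1) - X k) = V (k + 1) - V k := fun k hk =>
    div_mul_cancel₀ _ (sub_pos.2 (hX k hk)).ne'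
  have hsmono : ∀ k j, k ≤ j → j ≤ n → s k ≤ s j := by
    intro k j hkj
    induction j, hkj using Nat.le_induction with
    | base => intro _; exact le_rfl
    | succ j _ ih => intro hj; exact (ih (by omega)).trans (hslope j hj)
  have hle : ∀ k ≤ n, ∀ j ≤ n + 1, l k (X j) ≤ V j := by
    intro k hk j hj
    rcases le_total k j with h | h
    · induction j, h using Nat.le_induction with
      | base => simp [hl]
      | succ j hkj ih =>
        have h1 := ih (by omega)
        have h2 := mul_le_mul_of_nonneg_right (hsmono k j hkj (by omega))
          (sub_pos.2 (hX j (by omega))).le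
        have h3 := hstep j (by omega)
        simp only [hl] at h1 ⊢
        nlinarith
    · induction k, h using Nat.le_induction with
      | base => simp [hl]
      | succ k hjk ih =>
        have h1 := ih (by omega)
        have h2 := mul_le_mul_of_nonneg_right (hsmono k (k + 1) (by omega) hk)
          (sub_nonneg.2 (hXmono j (k + 1) (by omega) (by omega)))
        have h3 := hstep k (by omega)
        simp only [hl] at h1 ⊢
        nlinarith
  have hne : (Finset.range (n + 1)).Nonempty := ⟨0, by simp⟩
  set f : ℝ → ℝ := fun y => (Finset.range (n + 1)).sup' hne fun k => l k y with hf
  have hlf : ∀ k ≤ n, ∀ y, l k y ≤ f y := fun k hk y =>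
    Finset.le_sup' (fun k => l k y) (Finset.mem_range.2 (by omega))
  refine ⟨f, ⟨convex_univ, fun y _ z _ α β hα hβ hαβ => ?_⟩, fun y hy => ⟨?_, ?_⟩, fun i hi => ?_⟩
  · refine Finset.sup'_le _ _ fun k hk => ?_
    have hk' : k ≤ n := by have := Finset.mem_range.1 hk; omega
    have h1 := mul_le_mul_of_nonneg_left (hlf k hk' y) hα
    have h2 := mul_le_mul_of_nonneg_left (hlf k hk' z) hβ
    have h3 : l k (α • y + β • z) = α * l k y + β * l k z := by
      simp only [hl, smul_eq_mul]
      obtain rfl : α = 1 - β := by linarith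
      ring
    rw [h3]
    exact add_le_add h1 h2
  · obtain ⟨k, hk, h1, h2⟩ := exists_bracket n hy.1 hy.2
    refine le_trans ?_ (hlf k hk y)
    have hΔ := sub_pos.2 (hX k hk)
    have h3 : l k y * (X (k + 1) - X k) = V k * (X (k + 1) - y) + V (k + 1) * (y - X k) := by
      have := hstep k hk
      simp only [hl]
      linear_combination (y - X k) * this
    refine nonneg_of_mul_nonneg_left ?_ hΔ
    rw [h3]
    exact add_nonneg (mul_nonneg (hV k (by omega)).1 (by linarith))
      (mul_nonneg (hV (k + 1) (by omega)).1 (by linarith))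
  · refine Finset.sup'_le _ _ fun k hk => ?_
    have hk' : k ≤ n := by have := Finset.mem_range.1 hk; omega
    rcases le_total 0 (s k) with h | h
    · refine le_trans ?_ ((hle k hk' (n + 1) le_rfl).trans (hV _ le_rfl).2)
      have := mul_le_mul_of_nonneg_left hy.2 h
      simp only [hl]; linarith
    · refine le_trans ?_ ((hle k hk' 0 (by omega)).trans (hV _ (by omega)).2)
      have := mul_le_mul_of_nonpos_left hy.1 h
      simp only [hl]; linarith
  · refine le_antisymm (Finset.sup'_le _ _ fun k hk => ?_) ?_
    · exact hle k (by have := Finset.mem_range.1 hk; omega) i hi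
    · rcases Nat.lt_or_ge i (n + 1) with h | h
      · have := hlf i (by omega) (X i)
        simpa [hl] using this
      · obtain rfl : i = n + 1 := by omega
        have := hlf n le_rfl (X (n + 1))
        have h3 := hstep n le_rfl
        simp only [hl] at this
        linarith

section Order

variable {a b c : ℝ} {n : ℕ} {x : Fin n → ℝ}

theorem orderStat_zero : orderStat a b x 0 = a := by simp [orderStat, padded]

theorem orderStat_last : orderStat a b x (n + 1) = b := by simp [orderStat, padded]

theorem orderVal_zero (g : ℝ → ℝ) (v : Fin n → ℝ) (lo hi : ℝ) : orderVal g x v lo hi 0 = lo := by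
  simp [orderVal, padded]

theorem orderVal_last (g : ℝ → ℝ) (v : Fin n → ℝ) (lo hi : ℝ) :
    orderVal g x v lo hi (n + 1) = hi := by simp [orderVal, padded]

theorem exists_eq_orderStat (j : Fin n) : ∃ i, 1 ≤ i ∧ i ≤ n ∧ orderStat a b x i = x j ∧
    ∀ (g : ℝ → ℝ) (v : Fin n → ℝ) (lo hi : ℝ), orderVal g x v lo hi i = v j * g (x j) := by
  have h : ((Tuple.sort x).symm j : ℕ) + 1 ≤ n := ((Tuple.sort x).symm j).2
  refine ⟨((Tuple.sort x).symm j : ℕ) + 1, by omega, h, ?_, fun g v lo hi => ?_⟩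
  · simp [orderStat, padded, h]
  · simp [orderVal, padded, h]

theorem exists_orderStat_eq {i : ℕ} (h1 : 1 ≤ i) (hn : i ≤ n) : ∃ j : Fin n,
    orderStat a b x i = x j ∧
    ∀ (g : ℝ → ℝ) (v : Fin n → ℝ) (lo hi : ℝ), orderVal g x v lo hi i = v j * g (x j) := by
  refine ⟨Tuple.sort x ⟨i - 1, by omega⟩, ?_, fun g v lo hi => ?_⟩
  · simp [orderStat, padded, h1, hn]
  · simp [orderVal, padded, h1, hn]

theorem orderStat_lt_succ (hab : a < b) (hinj : Function.Injective x) (hx : ∀ i, x i ∈ Ioo a b)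
    {i : ℕ} (hi : i ≤ n) : orderStat a b x i < orderStat a b x (i + 1) := by
  rcases Nat.eq_zero_or_pos i with rfl | hpos
  · rw [orderStat_zero]
    rcases Nat.eq_zero_or_pos n with rfl | hn
    · rwa [orderStat_last]
    · obtain ⟨j, hj, -⟩ := exists_orderStat_eq (a := a) (b := b) (x := x) (i := 0 + 1) le_rfl hn
      rw [hj]; exact (hx j).1
  rcases hi.eq_or_lt with rfl | hlt
  · rw [orderStat_last]
    obtain ⟨j, hj, -⟩ := exists_orderStat_eq (a := a) (b := b) (x := x) hpos le_rfl
    rw [hj]; exact (hx j).2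
  · have h1 : 1 ≤ i ∧ i ≤ n := ⟨hpos, hi⟩
    have h2 : 1 ≤ i + 1 ∧ i + 1 ≤ n := ⟨by omega, hlt⟩
    have hmono : StrictMono (x ∘ Tuple.sort x) :=
      (Tuple.monotone_sort x).strictMono_of_injective (hinj.comp (Tuple.sort x).injective)
    simp only [orderStat, padded, dif_pos h1, dif_pos h2]
    exact hmono (show (⟨i - 1, _⟩ : Fin n) < ⟨i + 1 - 1, _⟩ by
      rw [Fin.lt_def]; dsimp only; omega)

theorem orderStat_lt (hab : a < b) (hinj : Function.Injective x) (hx : ∀ i, x i ∈ Ioo a b)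
    {i j : ℕ} (hij : i < j) (hj : j ≤ n + 1) : orderStat a b x i < orderStat a b x j := by
  induction j, hij using Nat.le_induction with
  | base => exact orderStat_lt_succ hab hinj hx (by omega)
  | succ j hij ih => exact (ih (by omega)).trans (orderStat_lt_succ hab hinj hx (by omega))

theorem le_of_orderStat_le (hab : a < b) (hinj : Function.Injective x) (hx : ∀ i, x i ∈ Ioo a b)
    {i j : ℕ} (hi : i ≤ n + 1) (h : orderStat a b x i ≤ orderStat a b x j) : i ≤ j := by
  by_contra hlt
  exact absurd h (not_le.2 (orderStat_lt hab hinj hx (not_le.1 hlt) hi))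

theorem orderStat_mem (hab : a < b) (hinj : Function.Injective x) (hx : ∀ i, x i ∈ Ioo a b)
    {i : ℕ} (hi : i ≤ n + 1) : orderStat a b x i ∈ Icc a b := by
  constructor
  · rcases Nat.eq_zero_or_pos i with rfl | h
    · rw [orderStat_zero]
    · exact orderStat_zero.symm.le.trans (orderStat_lt hab hinj hx h hi).le
  · rcases hi.eq_or_lt with rfl | h
    · rw [orderStat_last]
    · exact (orderStat_lt hab hinj hx h le_rfl).le.trans_eq orderStat_last

variable {M : ℝ} {g : ℝ → ℝ}

theorem orderVal_eq_apply (a b : ℝ) (hg : ∀ i, 0 < g (x i)) (f : ℝ → ℝ) (lo hi : ℝ) {i : ℕ}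
    (h1 : 1 ≤ i) (hn : i ≤ n) :
    orderVal g x (fun i => f (x i) / g (x i)) lo hi i = f (orderStat a b x i) := by
  obtain ⟨j, hj, hV⟩ := exists_orderStat_eq (a := a) (b := b) (x := x) h1 hn
  rw [hV, hj, div_mul_cancel₀ _ (hg j).ne']

theorem evalAt_mem_discreteShape (hab : a < b) (hinj : Function.Injective x)
    (hx : ∀ i, x i ∈ Ioo a b) (hg : ∀ y ∈ Icc a b, 0 < g y) {s : Shape} {f : ℝ → ℝ}
    (hf : f ∈ shapeClass a b c M s) :
    evalAt a b s x (fun y => f y / g y) ∈ discreteShape a b c M g x s := by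
  have hxI : ∀ i, x i ∈ Icc a b := fun i => Ioo_subset_Icc_self (hx i)
  have hgx : ∀ i, 0 < g (x i) := fun i => hg _ (hxI i)
  have hV : ∀ (lo hi : ℝ) {i : ℕ}, 1 ≤ i → i ≤ n →
      orderVal g x (fun i => f (x i) / g (x i)) lo hi i = f (orderStat a b x i) :=
    fun lo hi _ h1 hn => orderVal_eq_apply a b hgx f lo hi h1 hn
  have hmem : ∀ {i : ℕ}, i ≤ n + 1 → orderStat a b x i ∈ Icc a b :=
    fun hi => orderStat_mem hab hinj hx hi
  have hlt : ∀ {i : ℕ}, i ≤ n → orderStat a b x i < orderStat a b x (i + 1) :=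
    fun hi => orderStat_lt_succ hab hinj hx hi
  have hbd : ∀ i, 0 ≤ f (x i) / g (x i) * g (x i) ∧ f (x i) / g (x i) * g (x i) ≤ M := fun i => by
    rw [div_mul_cancel₀ _ (hgx i).ne']; exact hf.1 _ (hxI i)
  cases s with
  | monotonicity =>
    refine ⟨fun i h1 hn => ?_, hbd⟩
    simp only [evalAt]
    rw [hV _ _ (by omega) hn, hV _ _ h1 (by omega)]
    exact hf.2 (hmem (by omega)) (hmem (by omega)) (hlt (by omega)).le
  | convexity =>
    have ha : a ∈ Icc a b := left_mem_Icc.2 hab.le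
    have hb : b ∈ Icc a b := right_mem_Icc.2 hab.le
    have hV' : ∀ i ≤ n + 1, orderVal g x (fun i => f (x i) / g (x i)) (f a / g a * g a)
        (f b / g b * g b) i = f (orderStat a b x i) := by
      intro i hi
      rcases Nat.eq_zero_or_pos i with rfl | hpos
      · rw [orderVal_zero, orderStat_zero, div_mul_cancel₀ _ (hg a ha).ne']
      rcases hi.eq_or_lt with rfl | hlt'
      · rw [orderVal_last, orderStat_last, div_mul_cancel₀ _ (hg b hb).ne']
      · exact hV _ _ hpos (by omega)
    refine ⟨fun i hn => ?_, fun i hi => ?_⟩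
    · simp only [evalAt, Shape.ends]
      rw [hV' _ (by omega), hV' _ (by omega), hV' _ (by omega)]
      exact ConvexOn.slope_mono_adjacent hf.2 (hmem (by omega)) (hmem (by omega))
        (hlt (by omega)) (hlt (by omega))
    · simp only [evalAt, Shape.ends]
      rw [hV' _ hi]
      exact hf.1 _ (hmem hi)
  | unimodality =>
    refine ⟨fun i h1 hn => ⟨fun hc => ?_, fun hc => ?_⟩, hbd⟩
    · simp only [evalAt]
      rw [hV _ _ h1 hn]
      rcases Nat.lt_or_ge 1 i with h | h
      · have hl := hlt (i := i - 1) (by omega)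
        rw [Nat.sub_add_cancel h1] at hl
        rw [hV _ _ (by omega) (by omega)]
        exact hf.2.1 ⟨(hmem (by omega)).1, hl.le.trans hc⟩ ⟨(hmem (by omega)).1, hc⟩ hl.le
      · obtain rfl : i = 1 := by omega
        rw [show 1 - 1 = 0 from rfl, orderVal_zero]
        exact (hf.1 _ (hmem (by omega))).1
    · simp only [evalAt]
      rw [hV _ _ h1 hn]
      rcases hn.eq_or_lt with rfl | h
      · rw [orderVal_last]
        exact (hf.1 _ (hmem (by omega))).1
      · have hl := hlt (i := i) hn
        rw [hV _ _ (by omega) (by omega)]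
        exact hf.2.2 ⟨hc, (hmem (by omega)).2⟩ ⟨hc.trans hl.le, (hmem (by omega)).2⟩ hl.le

theorem exists_shape_extension (hab : a < b) (hM : 0 < M) (hinj : Function.Injective x)
    (hx : ∀ i, x i ∈ Ioo a b) (hxc : ∀ i, x i ≠ c) (hg : ∀ y ∈ Icc a b, 0 < g y) {s : Shape}
    {p : (Fin n → ℝ) × s.Ends} (hp : p ∈ discreteShape a b c M g x s) :
    ∃ f ∈ shapeClass a b c M s, evalAt a b s x (fun y => f y / g y) = p := by
  have hxI : ∀ i, x i ∈ Icc a b := fun i => Ioo_subset_Icc_self (hx i)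
  have hgx : ∀ i, 0 < g (x i) := fun i => hg _ (hxI i)
  set w : ℝ → ℝ := Function.extend x (fun i => p.1 i * g (x i)) 0 with hw
  have hwx : ∀ i, w (x i) = p.1 i * g (x i) := fun i => hinj.extend_apply _ _ i
  have hval : ∀ {f : ℝ → ℝ}, (∀ i, f (x i) = w (x i)) → (fun i => f (x i) / g (x i)) = p.1 := by
    intro f hf
    ext i
    rw [hf, hwx, mul_div_cancel_right₀ _ (hgx i).ne']
  cases s with
  | monotonicity =>
    have hchain : ∀ i j, 1 ≤ i → i ≤ j → j ≤ n →
        orderVal g x p.1 0 0 j ≤ orderVal g x p.1 0 0 i := by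
      intro i j h1 hij
      induction j, hij using Nat.le_induction with
      | base => intro _; exact le_rfl
      | succ j hij ih => intro hj; exact (hp.1 j (by omega) hj).trans (ih (by omega))
    have hanti : AntitoneOn w (range x) := by
      rintro _ ⟨i, rfl⟩ _ ⟨j, rfl⟩ hij
      obtain ⟨i', hi1, hin, hiX, hiV⟩ := exists_eq_orderStat (a := a) (b := b) (x := x) i
      obtain ⟨j', hj1, hjn, hjX, hjV⟩ := exists_eq_orderStat (a := a) (b := b) (x := x) j
      rw [hwx, hwx, ← hiV g p.1 0 0, ← hjV g p.1 0 0]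
      exact hchain _ _ hi1 (le_of_orderStat_le hab hinj hx (by omega) (by rwa [hiX, hjX])) hjn
    obtain ⟨G, hG, hG01, hGw⟩ := hanti.exists_antitone_extension_bounded hM.le
      (by rintro _ ⟨i, rfl⟩; rw [hwx]; exact hp.2 i)
    refine ⟨G, ⟨fun y _ => hG01 y, hG.antitoneOn _⟩, ?_⟩
    exact Prod.ext (hval fun i => hGw _ (mem_range_self i)) rfl
  | convexity =>
    have ha : a ∈ Icc a b := left_mem_Icc.2 hab.le
    have hb : b ∈ Icc a b := right_mem_Icc.2 hab.le
    obtain ⟨f, hf, hf01, hfV⟩ := exists_convex_interpolation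
      (X := orderStat a b x) (V := orderVal g x p.1 (p.2.1 * g a) (p.2.2 * g b))
      (fun i hi => orderStat_lt_succ hab hinj hx hi) hp.1 hp.2
    rw [orderStat_zero, orderStat_last] at hf01
    refine ⟨f, ⟨hf01, hf.subset (subset_univ _) (convex_Icc a b)⟩, ?_⟩
    refine Prod.ext (hval fun i => ?_) (Prod.ext ?_ ?_)
    · obtain ⟨i', hi1, hin, hiX, hiV⟩ := exists_eq_orderStat (a := a) (b := b) (x := x) i
      rw [hwx, ← hiX, hfV i' (by omega), hiV, hiX]
    · have := hfV 0 (by omega)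
      rw [orderStat_zero, orderVal_zero] at this
      simp only [evalAt, Shape.ends]
      rw [this, mul_div_cancel_right₀ _ (hg a ha).ne']
    · have := hfV (n + 1) le_rfl
      rw [orderStat_last, orderVal_last] at this
      simp only [evalAt, Shape.ends]
      rw [this, mul_div_cancel_right₀ _ (hg b hb).ne']
  | unimodality =>
    have hup : ∀ i j, 1 ≤ i → i ≤ j → j ≤ n → orderStat a b x j ≤ c →
        orderVal g x p.1 0 0 i ≤ orderVal g x p.1 0 0 j := by
      intro i j h1 hij
      induction j, hij using Nat.le_induction with
      | base => intro _ _; exact le_rfl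
      | succ j hij ih =>
        intro hj hc
        have := (hp.1 (j + 1) (by omega) hj).1 hc
        exact (ih (by omega) ((orderStat_lt_succ hab hinj hx (by omega)).le.trans hc)).trans this
    have hdown : ∀ i j, 1 ≤ i → i ≤ j → j ≤ n → c ≤ orderStat a b x i →
        orderVal g x p.1 0 0 j ≤ orderVal g x p.1 0 0 i := by
      intro i j h1 hij
      induction j, hij using Nat.le_induction with
      | base => intro _ _; exact le_rfl
      | succ j hij ih =>
        intro hj hc
        have hcj : c ≤ orderStat a b x j := by
          rcases hij.eq_or_lt with rfl | h
          · exact hc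
          · exact hc.trans (orderStat_lt hab hinj hx h (by omega)).le
        exact ((hp.1 j (by omega) (by omega)).2 hcj).trans (ih (by omega) hc)
    have hmono : MonotoneOn w (range x ∩ Iic c) := by
      rintro _ ⟨⟨i, rfl⟩, hic⟩ _ ⟨⟨j, rfl⟩, hjc⟩ hij
      obtain ⟨i', hi1, hin, hiX, hiV⟩ := exists_eq_orderStat (a := a) (b := b) (x := x) i
      obtain ⟨j', hj1, hjn, hjX, hjV⟩ := exists_eq_orderStat (a := a) (b := b) (x := x) j
      rw [hwx, hwx, ← hiV g p.1 0 0, ← hjV g p.1 0 0]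
      exact hup _ _ hi1 (le_of_orderStat_le hab hinj hx (by omega) (by rwa [hiX, hjX])) hjn
        (by rwa [hjX])
    have hanti : AntitoneOn w (range x ∩ Ici c) := by
      rintro _ ⟨⟨i, rfl⟩, hic⟩ _ ⟨⟨j, rfl⟩, hjc⟩ hij
      obtain ⟨i', hi1, hin, hiX, hiV⟩ := exists_eq_orderStat (a := a) (b := b) (x := x) i
      obtain ⟨j', hj1, hjn, hjX, hjV⟩ := exists_eq_orderStat (a := a) (b := b) (x := x) j
      rw [hwx, hwx, ← hiV g p.1 0 0, ← hjV g p.1 0 0]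
      exact hdown _ _ hi1 (le_of_orderStat_le hab hinj hx (by omega) (by rwa [hiX, hjX])) hjn
        (by rwa [hiX])
    obtain ⟨G, hG, hG01, hGw⟩ := hmono.exists_monotone_extension_bounded hM.le
      (by rintro _ ⟨⟨i, rfl⟩, -⟩; rw [hwx]; exact hp.2 i)
    obtain ⟨H, hH, hH01, hHw⟩ := hanti.exists_antitone_extension_bounded hM.le
      (by rintro _ ⟨⟨i, rfl⟩, -⟩; rw [hwx]; exact hp.2 i)
    set f : ℝ → ℝ := fun y => if y < c then G y else if y = c then M else H y with hf
    have f_lt : ∀ {y}, y < c → f y = G y := fun h => if_pos h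
    have f_eq : f c = M := by simp [hf]
    have f_gt : ∀ {y}, c < y → f y = H y := fun {y} h => by
      simp [hf, not_lt.2 h.le, h.ne']
    have f01 : ∀ y, 0 ≤ f y ∧ f y ≤ M := by
      intro y
      rcases lt_trichotomy y c with h | h | h
      · rw [f_lt h]; exact hG01 y
      · rw [h, f_eq]; exact ⟨hM.le, le_rfl⟩
      · rw [f_gt h]; exact hH01 y
    refine ⟨f, ⟨fun y _ => f01 y, fun y hy z hz hyz => ?_, fun y hy z hz hyz => ?_⟩, ?_⟩
    · rcases hz.2.eq_or_lt with h | h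
      · rw [h, f_eq]; exact (f01 y).2
      · rw [f_lt h, f_lt (hyz.trans_lt h)]; exact hG hyz
    · rcases hy.1.eq_or_lt with h | h
      · rw [← h, f_eq]; exact (f01 z).2
      · rw [f_gt h, f_gt (h.trans_le hyz)]; exact hH hyz
    · refine Prod.ext (hval fun i => ?_) rfl
      rcases lt_or_gt_of_ne (hxc i) with h | h
      · rw [f_lt h]; exact hGw _ ⟨mem_range_self i, h.le⟩
      · rw [f_gt h]; exact hHw _ ⟨mem_range_self i, h.le⟩

theorem evalAt_image_ratioClass (hab : a < b) (hM : 0 < M) (hinj : Function.Injective x)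
    (hx : ∀ i, x i ∈ Ioo a b) (hxc : ∀ i, x i ≠ c) (hg : ∀ y ∈ Icc a b, 0 < g y) (s : Shape) :
    evalAt a b s x '' ratioClass a b c M g s = discreteShape a b c M g x s := by
  ext p
  constructor
  · rintro ⟨_, ⟨f, hf, rfl⟩, rfl⟩
    exact evalAt_mem_discreteShape hab hinj hx hg hf
  · intro hp
    obtain ⟨f, hf, h⟩ := exists_shape_extension hab hM hinj hx hxc hg hp
    exact ⟨_, ⟨f, hf, rfl⟩, h⟩

theorem evalAt_image_feasible {s : Shape} {m q : ℕ} (φ : Fin m ⊕ Fin q → ℝ → ℝ)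
    (μ : Fin m ⊕ Fin q → ℝ)
    (h : evalAt a b s x '' ratioClass a b c M g s = discreteShape a b c M g x s) :
    evalAt a b s x '' feasible (sampleMean x) (ratioClass a b c M g s) φ μ
      = lpFeasible a b c M g s φ μ x := by
  ext p
  constructor
  · rintro ⟨L, ⟨h1, h2, h3⟩, rfl⟩
    exact ⟨h1, h2, h ▸ mem_image_of_mem _ h3⟩
  · rintro ⟨h1, h2, h3⟩
    rw [← h] at h3
    obtain ⟨L, hL, rfl⟩ := h3
    exact ⟨L, ⟨h1, h2, hL⟩, rfl⟩

theorem value_eq_lpValue {s : Shape} {m q : ℕ} (φ₀ : ℝ → ℝ) (φ : Fin m ⊕ Fin q → ℝ → ℝ)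
    (μ : Fin m ⊕ Fin q → ℝ)
    (h : evalAt a b s x '' ratioClass a b c M g s = discreteShape a b c M g x s) :
    value (sampleMean x) (ratioClass a b c M g s) φ₀ φ μ = lpValue a b c M g s φ₀ φ μ x := by
  rw [lpValue, ← evalAt_image_feasible φ μ h, iSup_image]
  rfl

end Order

/-! ### The sampling law -/

section SamplingLaw

variable {a b : ℝ} {g : ℝ → ℝ}

theorem samplingLaw_absolutelyContinuous :
    samplingLaw a b g ≪ volume.restrict (Icc a b) := withDensity_absolutelyContinuous _ _

theorem nullSingletonClass_samplingLaw : NullSingletonClass (samplingLaw a b g) :=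
  ⟨fun x => samplingLaw_absolutelyContinuous (measure_singleton x)⟩

theorem ae_samplingLaw_mem : ∀ᵐ y ∂(samplingLaw a b g), y ∈ Icc a b :=
  samplingLaw_absolutelyContinuous.ae_le (ae_restrict_mem measurableSet_Icc)

theorem memLp_div_samplingLaw (hg_meas : AEMeasurable g (volume.restrict (Icc a b))) {η : ℝ}
    (hη : 0 < η) (hg : ∀ x ∈ Icc a b, η ≤ g x) {φ : ℝ → ℝ} {δ : ℝ} (hδ : 0 < δ)
    (hφm : AEMeasurable φ (volume.restrict (Icc a b)))
    (hφ : IntegrableOn (fun x => |φ x| ^ (2 + δ)) (Icc a b)) :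
    MemLp (fun x => φ x / g x) 2 (samplingLaw a b g) := by
  have hm : AEMeasurable (fun x => φ x / g x) (volume.restrict (Icc a b)) := hφm.div hg_meas
  have hm' : AEStronglyMeasurable (fun x => φ x / g x) (samplingLaw a b g) :=
    hm.aestronglyMeasurable.mono_ac samplingLaw_absolutelyContinuous
  rw [memLp_two_iff_integrable_sq hm', samplingLaw,
    integrable_withDensity_iff_integrable_smul₀' hg_meas.ennreal_ofReal
      (Eventually.of_forall fun _ => ENNReal.ofReal_lt_top)]
  have hdom : Integrable (fun x => η⁻¹ * (1 + |φ x| ^ (2 + δ))) (volume.restrict (Icc a b)) :=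
    ((integrable_const 1).add hφ).const_mul _
  refine hdom.mono' (hg_meas.ennreal_ofReal.ennreal_toReal.mul
    (hm.pow_const 2)).aestronglyMeasurable ?_
  filter_upwards [ae_restrict_mem measurableSet_Icc] with x hx
  have hgx : 0 < g x := hη.trans_le (hg x hx)
  rw [ENNReal.toReal_ofReal hgx.le, smul_eq_mul, Real.norm_eq_abs, abs_of_nonneg (by positivity)]
  have h1 : g x * (φ x / g x) ^ 2 = (g x)⁻¹ * φ x ^ 2 := by field_simp
  rw [h1]
  refine mul_le_mul (inv_anti₀ hη (hg x hx)) ?_ (sq_nonneg _) (by positivity)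
  rcases le_total |φ x| 1 with h | h
  · have : φ x ^ 2 ≤ 1 := by rw [← sq_abs]; exact pow_le_one₀ (abs_nonneg _) h
    have : 0 ≤ |φ x| ^ (2 + δ) := by positivity
    linarith
  · have : |φ x| ^ (2 : ℝ) ≤ |φ x| ^ (2 + δ) :=
      Real.rpow_le_rpow_of_exponent_le h (by linarith)
    rw [Real.rpow_two, sq_abs] at this
    linarith

end SamplingLaw

theorem ae_injective_sample {Ω : Type*} [MeasurableSpace Ω] {P : Measure Ω}
    [IsProbabilityMeasure P] {ν : Measure ℝ} [NullSingletonClass ν] {X : ℕ → Ω → ℝ}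
    (hX : ∀ i, HasLaw (X i) ν P) (hind : iIndepFun X P) :
    ∀ᵐ ω ∂P, Function.Injective fun i => X i ω := by
  have hne : ∀ i j : ℕ, i ≠ j → ∀ᵐ ω ∂P, X i ω ≠ X j ω := by
    intro i j hij
    have hprob : IsProbabilityMeasure ν := (hX 0).map_eq ▸
      Measure.isProbabilityMeasure_map (hX 0).aemeasurable
    have hlaw := (indepFun_iff_map_prod_eq_prod_map_map (hX i).aemeasurable
      (hX j).aemeasurable).1 (hind.indepFun hij)
    rw [(hX i).map_eq, (hX j).map_eq] at hlaw
    have hdiag : ∀ᵐ p ∂(ν.prod ν), p.1 ≠ p.2 := by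
      have hms : MeasurableSet {p : ℝ × ℝ | p.1 ≠ p.2} :=
        (measurableSet_eq_fun measurable_fst measurable_snd).compl
      rw [Measure.ae_prod_iff_ae_ae hms]
      refine Eventually.of_forall fun y => ?_
      have : ∀ᵐ z ∂ν, z ≠ y := by rw [ae_iff]; simp
      filter_upwards [this] with z hz using hz.symm
    rw [← hlaw] at hdiag
    exact ae_of_ae_map ((hX i).aemeasurable.prodMk (hX j).aemeasurable) hdiag
  have : ∀ᵐ ω ∂P, ∀ i j : ℕ, i ≠ j → X i ω ≠ X j ω :=
    ae_all_iff.2 fun i => ae_all_iff.2 fun j => by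
      by_cases h : i = j
      · simp [h]
      · simpa [h] using hne i j h
  filter_upwards [this] with ω hω i j hij
  by_contra h
  exact hω i j h hij

/-! ### The class of likelihood ratios -/

theorem convex_shapeClass (a b c M : ℝ) (s : Shape) : Convex ℝ (shapeClass a b c M s) := by
  rintro f ⟨hf01, hf⟩ k ⟨hk01, hk⟩ α β hα hβ hαβ
  refine ⟨fun y hy => ?_, ?_⟩
  · have h1 := hf01 y hy
    have h2 := hk01 y hy
    simp only [Pi.add_apply, Pi.smul_apply, smul_eq_mul]
    refine ⟨add_nonneg (mul_nonneg hα h1.1) (mul_nonneg hβ h2.1), ?_⟩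
    obtain rfl : α = 1 - β := by linarith
    nlinarith [mul_le_mul_of_nonneg_left h1.2 hα, mul_le_mul_of_nonneg_left h2.2 hβ]
  · have hanti : ∀ {S : Set ℝ}, AntitoneOn f S → AntitoneOn k S → AntitoneOn (α • f + β • k) S :=
      fun h1 h2 y hy z hz hyz => add_le_add (mul_le_mul_of_nonneg_left (h1 hy hz hyz) hα)
        (mul_le_mul_of_nonneg_left (h2 hy hz hyz) hβ)
    have hmono : ∀ {S : Set ℝ}, MonotoneOn f S → MonotoneOn k S → MonotoneOn (α • f + β • k) S :=
      fun h1 h2 y hy z hz hyz => add_le_add (mul_le_mul_of_nonneg_left (h1 hy hz hyz) hα)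
        (mul_le_mul_of_nonneg_left (h2 hy hz hyz) hβ)
    cases s with
    | monotonicity => exact hanti hf hk
    | convexity => exact (ConvexOn.smul hα hf).add (ConvexOn.smul hβ hk)
    | unimodality => exact ⟨hmono hf.1 hk.1, hanti hf.2 hk.2⟩

theorem convex_ratioClass (a b c M : ℝ) (g : ℝ → ℝ) (s : Shape) :
    Convex ℝ (ratioClass a b c M g s) := by
  rintro _ ⟨f, hf, rfl⟩ _ ⟨k, hk, rfl⟩ α β hα hβ hαβ
  refine ⟨_, convex_shapeClass a b c M s hf hk hα hβ hαβ, ?_⟩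
  ext y
  simp only [Pi.add_apply, Pi.smul_apply, smul_eq_mul]
  ring

theorem isAffineOn_sampleMean {n : ℕ} (x : Fin n → ℝ) (C : Set (ℝ → ℝ)) (φ : ℝ → ℝ) :
    IsAffineOn C fun L => sampleMean x fun y => φ y * L y := by
  intro L _ L' _ t _ _
  simp only [sampleMean, Pi.add_apply, Pi.smul_apply, smul_eq_mul, mul_add, Finset.sum_add_distrib,
    Finset.mul_sum]
  congr 1 <;> exact Finset.sum_congr rfl fun i _ => by ring

section Moments

variable {a b c M : ℝ} {g : ℝ → ℝ} {s : Shape} {φ : ℝ → ℝ}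

theorem integrable_mul_ratioClass (hψ : Integrable (fun x => φ x / g x) (samplingLaw a b g))
    {L : ℝ → ℝ} (hL : L ∈ ratioClass a b c M g s) :
    Integrable (fun y => φ y * L y) (samplingLaw a b g) := by
  obtain ⟨f, hf, rfl⟩ := hL
  refine (integrable_mul_of_mem_shapeClass hψ ae_samplingLaw_mem hf).congr
    (Eventually.of_forall fun y => ?_)
  dsimp only; ring

theorem isAffineOn_expect (hψ : Integrable (fun x => φ x / g x) (samplingLaw a b g)) :
    IsAffineOn (ratioClass a b c M g s) fun L => expect a b g fun y => φ y * L y := by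
  intro L hL L' hL' t _ _
  have h1 := integrable_mul_ratioClass hψ hL
  have h2 := integrable_mul_ratioClass hψ hL'
  simp only [expect]
  rw [← integral_const_mul, ← integral_const_mul, ← integral_add (h1.const_mul _) (h2.const_mul _)]
  refine integral_congr_ae (Eventually.of_forall fun y => ?_)
  simp only [Pi.add_apply, Pi.smul_apply, smul_eq_mul]; ring

theorem abs_expect_le (hψ : Integrable (fun x => φ x / g x) (samplingLaw a b g))
    {L : ℝ → ℝ} (hL : L ∈ ratioClass a b c M g s) :
    |expect a b g fun y => φ y * L y| ≤ M * ∫ y, |φ y / g y| ∂(samplingLaw a b g) := by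
  obtain ⟨f, hf, rfl⟩ := hL
  rw [expect, ← integral_const_mul, ← Real.norm_eq_abs]
  refine norm_integral_le_of_norm_le (hψ.abs.const_mul M) ?_
  filter_upwards [ae_samplingLaw_mem] with y hy
  rw [show φ y * (f y / g y) = f y * (φ y / g y) by ring, Real.norm_eq_abs, abs_mul,
    abs_of_nonneg (hf.1 y hy).1]
  exact mul_le_mul_of_nonneg_right (hf.1 y hy).2 (abs_nonneg _)

theorem abs_sampleMean_sub_expect_le
    (hψ : Integrable (fun x => φ x / g x) (samplingLaw a b g)) (hM : 0 < M) {n : ℕ}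
    {x : Fin n → ℝ} (hx : ∀ i, x i ∈ Icc a b)
    (hfin : halfLineDev (samplingLaw a b g) (fun x => φ x / g x) x ≠ ⊤)
    {L : ℝ → ℝ} (hL : L ∈ ratioClass a b c M g s) :
    |(sampleMean x fun y => φ y * L y) - expect a b g fun y => φ y * L y|
      ≤ 3 * M * (halfLineDev (samplingLaw a b g) (fun x => φ x / g x) x).toReal := by
  obtain ⟨f, hf, rfl⟩ := hL
  have heq : (fun y => φ y * (f y / g y)) = fun y => φ y / g y * f y := by ext y; ring
  have := abs_meanDev_shapeClass_le (x := x) (D := (halfLineDev (samplingLaw a b g)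
    (fun x => φ x / g x) x).toReal) hψ (fun q => ?_) hM ae_samplingLaw_mem hx hf
  · rw [expect, heq]; exact this
  · refine (ENNReal.ofReal_le_iff_le_toReal hfin).1 ?_
    rw [← Real.enorm_eq_ofReal_abs]
    exact le_iSup (fun q : ℚ => ‖meanDev (samplingLaw a b g) x
      (truncBelow (fun x => φ x / g x) q)‖ₑ) q

end Moments

/-! ### Outer convergence from measurable bounds -/

section Outer

variable {Ω : Type*} [MeasurableSpace Ω] {P : Measure Ω} {Y : ℕ → Ω → EReal} {v : ℝ}
  {D : ℕ → Ω → ℝ≥0∞} {K ε₀ : ℝ}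

theorem tendstoOuterAS_of_bound [IsFiniteMeasure P] (hε₀ : 0 < ε₀)
    (hDm : ∀ n, AEMeasurable (D n) P)
    (hbound : ∀ᵐ ω ∂P, ∀ n, D n ω ≤ ENNReal.ofReal ε₀ →
      ∃ v' : ℝ, Y n ω = v' ∧ ENNReal.ofReal |v' - v| ≤ ENNReal.ofReal K * D n ω)
    (hlim : ∀ᵐ ω ∂P, Tendsto (fun n => D n ω) atTop (𝓝 0)) :
    TendstoOuterAS P Y (fun _ => (v : EReal)) := by
  choose U hU using fun n => exists_isMinMeasMajorant P (fun ω => (Y n ω - (v : EReal)).abs)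
  refine ⟨U, hU, ?_⟩
  set h : ℝ≥0∞ → ℝ≥0∞ := fun d => if d ≤ ENNReal.ofReal ε₀ then ENNReal.ofReal K * d else ⊤ with hh
  have hm : Measurable h :=
    Measurable.ite measurableSet_Iic (measurable_id.const_mul _) measurable_const
  have hUV : ∀ n, ∀ᵐ ω ∂P, U n ω ≤ h (D n ω) := by
    intro n
    refine ae_le_of_isMinMeasMajorant (hU n) (hm.comp_aemeasurable (hDm n)) ?_
    filter_upwards [hbound] with ω hω
    by_cases hc : D n ω ≤ ENNReal.ofReal ε₀
    · obtain ⟨v', hv', hle⟩ := hω n hc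
      rw [hv', ← EReal.coe_sub, EReal.abs_def]
      simp only [hh, if_pos hc]
      exact hle
    · simp only [hh, if_neg hc]; exact le_top
  filter_upwards [ae_all_iff.2 hUV, hlim] with ω h1 h2
  have h3 : Tendsto (fun n => ENNReal.ofReal K * D n ω) atTop (𝓝 0) := by
    have := ENNReal.Tendsto.const_mul (a := ENNReal.ofReal K) h2 (Or.inr ENNReal.ofReal_ne_top)
    rwa [mul_zero] at this
  refine tendsto_of_tendsto_of_tendsto_of_le_of_le' tendsto_const_nhds h3
    (Eventually.of_forall fun _ => zero_le) ?_
  filter_upwards [h2.eventually_le_const (ENNReal.ofReal_pos.2 hε₀)] with n hn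
  refine (h1 n).trans (le_of_eq ?_)
  simp only [hh, if_pos hn]

theorem isBigOOneOuter_of_bound (hε₀ : 0 < ε₀) (hK : 0 < K)
    (hDm : ∀ n, AEMeasurable (D n) P)
    (hbound : ∀ᵐ ω ∂P, ∀ n, D n ω ≤ ENNReal.ofReal ε₀ →
      ∃ v' : ℝ, Y n ω = v' ∧ ENNReal.ofReal |v' - v| ≤ ENNReal.ofReal K * D n ω)
    {c : ℝ} (hc : 0 ≤ c) (hE : ∀ n : ℕ, 0 < n → ∫⁻ ω, D n ω ∂P ≤ ENNReal.ofReal (c / √n)) :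
    IsBigOOneOuter P fun n ω => ((√(n : ℝ) : ℝ) : EReal) * (Y n ω - (v : EReal)) := by
  intro ε hε
  set κ := K * c / ε + 1 with hκ
  have hκ0 : 0 < κ := by positivity
  refine ⟨κ, hκ0, ?_⟩
  refine limsup_le_of_le (by isBoundedDefault) ?_
  have hlarge : ∀ᶠ n : ℕ in atTop, κ / (K * ε₀) ≤ √(n : ℝ) :=
    (Real.tendsto_sqrt_atTop.comp tendsto_natCast_atTop_atTop).eventually_ge_atTop _
  filter_upwards [hlarge, eventually_gt_atTop 0] with n hn hn0
  have hsn : 0 < √(n : ℝ) := Real.sqrt_pos.2 (by exact_mod_cast hn0)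
  set r := κ / (K * √n) with hr
  have hr0 : 0 < r := by positivity
  have hrε : r ≤ ε₀ := by
    rw [div_le_iff₀ (by positivity)] at hn
    rw [hr, div_le_iff₀ (by positivity)]
    linarith
  have hsub : ∀ᵐ ω ∂P, ω ∈ {ω | ENNReal.ofReal κ ≤
      (((√(n : ℝ) : ℝ) : EReal) * (Y n ω - (v : EReal))).abs} →
      ω ∈ {ω | ENNReal.ofReal r ≤ D n ω} := by
    filter_upwards [hbound] with ω hω hmem
    change ENNReal.ofReal κ ≤ (((√(n : ℝ) : ℝ) : EReal) * (Y n ω - (v : EReal))).abs at hmem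
    by_cases hcase : D n ω ≤ ENNReal.ofReal ε₀
    · obtain ⟨v', hv', hle⟩ := hω n hcase
      rw [hv', ← EReal.coe_sub, ← EReal.coe_mul, EReal.abs_def, abs_mul, abs_of_pos hsn,
        ENNReal.ofReal_mul hsn.le] at hmem
      have hfin : D n ω ≠ ⊤ := ne_top_of_le_ne_top ENNReal.ofReal_ne_top hcase
      have h1 := hmem.trans (mul_le_mul_right hle (ENNReal.ofReal √n))
      rw [← ENNReal.ofReal_toReal hfin, ← ENNReal.ofReal_mul hK.le, ← ENNReal.ofReal_mul hsn.le,
        ENNReal.ofReal_le_ofReal_iff (by positivity)] at h1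
      rw [← ENNReal.ofReal_toReal hfin]
      refine ENNReal.ofReal_le_ofReal ?_
      rw [hr, div_le_iff₀ (by positivity)]
      linarith
    · exact (ENNReal.ofReal_le_ofReal hrε).trans (not_le.1 hcase).le
  refine (measure_mono_ae hsub).trans ?_
  refine (meas_ge_le_lintegral_div (hDm n) (ENNReal.ofReal_pos.2 hr0).ne'
    ENNReal.ofReal_ne_top).trans ?_
  refine (ENNReal.div_le_div_right (hE n hn0) _).trans ?_
  rw [← ENNReal.ofReal_div_of_pos hr0]
  refine ENNReal.ofReal_le_ofReal ?_
  have : c / √n / r = K * c / κ := by rw [hr]; field_simp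
  rw [this, div_le_iff₀ hκ0, hκ]
  have : ε * (K * c / ε + 1) = K * c + ε := by field_simp
  linarith

end Outer

theorem corollary1
    {Ω : Type*} [MeasurableSpace Ω] (P : Measure Ω) [IsProbabilityMeasure P]
    (a b c M : ℝ) (hc : c ∈ Ioo a b) (hM : 0 < M) (s : Shape)
    -- the sampling density and the i.i.d. sample drawn from it
    (g : ℝ → ℝ) (hg_meas : AEMeasurable g (volume.restrict (Icc a b)))
    (hg_mass : ∫ x in Icc a b, g x = 1)
    (hg_inf : ∃ η : ℝ, 0 < η ∧ ∀ x ∈ Icc a b, η ≤ g x)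
    (X : ℕ → Ω → ℝ) (hX_law : ∀ i, HasLaw (X i) (samplingLaw a b g) P) (hX_indep : iIndepFun X P)
    -- objective, `m` inequality and `q` equality moment constraints
    {m q : ℕ} (φ₀ : ℝ → ℝ) (φ : Fin m ⊕ Fin q → ℝ → ℝ) (μ : Fin m ⊕ Fin q → ℝ)
    (δ : ℝ) (hδ : 0 < δ)
    (hφ₀_meas : AEMeasurable φ₀ (volume.restrict (Icc a b)))
    (hφ₀ : IntegrableOn (fun x => |φ₀ x| ^ (2 + δ)) (Icc a b))
    (hφ_meas : ∀ j, AEMeasurable (φ j) (volume.restrict (Icc a b)))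
    (hφ : ∀ j, IntegrableOn (fun x => |φ j x| ^ (2 + δ)) (Icc a b))
    (hSlater : SlaterCondition (expect a b g) (ratioClass a b c M g s) φ μ) :
    let C : Set (ℝ → ℝ) := ratioClass a b c M g s
    let x : (n : ℕ) → Ω → Fin n → ℝ := fun n ω i => X i ω
    let val : EReal := value (expect a b g) C φ₀ φ μ
    let valₙ : ℕ → Ω → EReal := fun n ω => value (sampleMean (x n ω)) C φ₀ φ μ
    -- finite-dimensional reduction to the linear program
    (∀ᵐ ω ∂P, ∀ n : ℕ, 1 ≤ n →
      evalAt a b s (x n ω) '' C = discreteShape a b c M g (x n ω) s ∧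
      evalAt a b s (x n ω) '' feasible (sampleMean (x n ω)) C φ μ
        = lpFeasible a b c M g s φ μ (x n ω) ∧
      valₙ n ω = lpValue a b c M g s φ₀ φ μ (x n ω)) ∧
    -- the optimal value is finite
    (val ≠ ⊥ ∧ val ≠ ⊤) ∧
    -- consistency and convergence rate
    TendstoOuterAS P valₙ (fun _ => val) ∧
    IsBigOOneOuter P (fun n ω => ((√(n : ℝ) : ℝ) : EReal) * (valₙ n ω - val)) := by
  intro C x val valₙ
  obtain ⟨η, hη, hgη⟩ := hg_inf
  have hab : a < b := hc.1.trans hc.2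
  have hgpos : ∀ y ∈ Icc a b, 0 < g y := fun y hy => hη.trans_le (hgη y hy)
  set ν := samplingLaw a b g with hν
  have hνprob : IsProbabilityMeasure ν := (hX_law 0).map_eq ▸
    Measure.isProbabilityMeasure_map (hX_law 0).aemeasurable
  have hνnull : NullSingletonClass ν := nullSingletonClass_samplingLaw
  have hmemI : ∀ᵐ ω ∂P, ∀ i, X i ω ∈ Icc a b := ae_forall_sample hX_law ae_samplingLaw_mem
  have hne : ∀ t : ℝ, ∀ᵐ ω ∂P, ∀ i, X i ω ≠ t := fun t =>
    ae_forall_sample hX_law (p := fun y => y ≠ t) (by rw [ae_iff]; simp)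
  have hψ₀ : MemLp (fun y => φ₀ y / g y) 2 ν :=
    memLp_div_samplingLaw hg_meas hη hgη hδ hφ₀_meas hφ₀
  have hψ : ∀ j, MemLp (fun y => φ j y / g y) 2 ν := fun j =>
    memLp_div_samplingLaw hg_meas hη hgη hδ (hφ_meas j) (hφ j)
  have hi₀ : Integrable (fun y => φ₀ y / g y) ν := hψ₀.integrable one_le_two
  have hi : ∀ j, Integrable (fun y => φ j y / g y) ν := fun j => (hψ j).integrable one_le_two
  -- deterministic stability of the optimal value
  set B := M * ∫ y, |φ₀ y / g y| ∂ν + ∑ j, M * ∫ y, |φ j y / g y| ∂ν with hB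
  have hnn : ∀ h : ℝ → ℝ, 0 ≤ M * ∫ y, |h y / g y| ∂ν := fun h =>
    mul_nonneg hM.le (integral_nonneg fun _ => abs_nonneg _)
  obtain ⟨v, hv, K, ε₀, hK, hε₀, hstab⟩ := exists_value_stability (convex_ratioClass a b c M g s)
    (isAffineOn_expect hi₀) (fun j => isAffineOn_expect (hi j)) (B := B)
    (fun L hL => (abs_expect_le hi₀ hL).trans
      (le_add_of_nonneg_right (Finset.sum_nonneg fun j _ => hnn (φ j))))
    (fun j L hL => (abs_expect_le (hi j) hL).trans ((Finset.single_le_sum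
      (f := fun j => M * ∫ y, |φ j y / g y| ∂ν) (fun j _ => hnn (φ j)) (Finset.mem_univ j)).trans
        (le_add_of_nonneg_left (hnn φ₀)))) hSlater
  -- the measurable bound on the deviations
  set D : ℕ → Ω → ℝ≥0∞ := fun n ω => halfLineDev ν (fun y => φ₀ y / g y) (fun i : Fin n => X i ω)
    + ∑ j, halfLineDev ν (fun y => φ j y / g y) (fun i : Fin n => X i ω) with hD
  have hDm₀ : ∀ n, AEMeasurable
      (fun ω => halfLineDev ν (fun y => φ₀ y / g y) (fun i : Fin n => X i ω)) P := fun n =>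
    aemeasurable_halfLineDev hX_law hi₀.aestronglyMeasurable.aemeasurable n
  have hDmj : ∀ j n, AEMeasurable
      (fun ω => halfLineDev ν (fun y => φ j y / g y) (fun i : Fin n => X i ω)) P := fun j n =>
    aemeasurable_halfLineDev hX_law (hi j).aestronglyMeasurable.aemeasurable n
  have hDm : ∀ n, AEMeasurable (D n) P := fun n =>
    (hDm₀ n).add (Finset.aemeasurable_fun_sum _ fun j _ => hDmj j n)
  have hlim : ∀ᵐ ω ∂P, Tendsto (fun n => D n ω) atTop (𝓝 0) := by
    have h1 := ae_tendsto_halfLineDev hX_law hX_indep hi₀ hab.le ae_samplingLaw_mem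
    have h2 := ae_all_iff.2 fun j =>
      ae_tendsto_halfLineDev hX_law hX_indep (hi j) hab.le ae_samplingLaw_mem
    filter_upwards [h1, h2] with ω h1 h2
    have := h1.add (tendsto_finsetSum Finset.univ fun j _ => h2 j)
    simpa only [Finset.sum_const_zero, add_zero] using this
  set e : (ℝ → ℝ) → ℝ := fun h => 2 * (4 * ∫ y, (h y / g y) ^ 2 ∂ν + 1) with he
  have he0 : ∀ h, 0 ≤ e h := fun h => by
    have : 0 ≤ ∫ y, (h y / g y) ^ 2 ∂ν := integral_nonneg fun _ => sq_nonneg _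
    simp only [he]; positivity
  have hE : ∀ n : ℕ, 0 < n → ∫⁻ ω, D n ω ∂P ≤ ENNReal.ofReal ((e φ₀ + ∑ j, e (φ j)) / √n) := by
    intro n hn
    rw [hD, lintegral_add_left' (hDm₀ n), lintegral_finsetSum' _ fun j _ => hDmj j n, add_div,
      Finset.sum_div, ENNReal.ofReal_add (div_nonneg (he0 _) (Real.sqrt_nonneg _))
        (Finset.sum_nonneg fun j _ => div_nonneg (he0 _) (Real.sqrt_nonneg _)),
      ENNReal.ofReal_sum_of_nonneg fun j _ => div_nonneg (he0 _) (Real.sqrt_nonneg _)]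
    exact add_le_add (lintegral_halfLineDev_le hX_law hX_indep hψ₀ hn)
      (Finset.sum_le_sum fun j _ => lintegral_halfLineDev_le hX_law hX_indep (hψ j) hn)
  have hbound : ∀ᵐ ω ∂P, ∀ n, D n ω ≤ ENNReal.ofReal (ε₀ / (3 * M)) →
      ∃ v' : ℝ, valₙ n ω = v' ∧
        ENNReal.ofReal |v' - v| ≤ ENNReal.ofReal (K * (3 * M)) * D n ω := by
    filter_upwards [hmemI] with ω hω n hn
    have hfin : D n ω ≠ ⊤ := ne_top_of_le_ne_top ENNReal.ofReal_ne_top hn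
    have hle₀ : halfLineDev ν (fun y => φ₀ y / g y) (x n ω) ≤ D n ω := le_self_add
    have hlej : ∀ j, halfLineDev ν (fun y => φ j y / g y) (x n ω) ≤ D n ω := fun j =>
      (Finset.single_le_sum (f := fun j => halfLineDev ν (fun y => φ j y / g y) (x n ω))
        (fun _ _ => zero_le) (Finset.mem_univ j)).trans le_add_self
    have hdev : ∀ h : ℝ → ℝ, Integrable (fun y => h y / g y) ν →
        halfLineDev ν (fun y => h y / g y) (x n ω) ≤ D n ω → ∀ L ∈ C,
        |(sampleMean (x n ω) fun y => h y * L y) - expect a b g fun y => h y * L y|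
          ≤ 3 * M * (D n ω).toReal := fun h hh hle L hL =>
      (abs_sampleMean_sub_expect_le hh hM (fun i => hω i) (ne_top_of_le_ne_top hfin hle) hL).trans
        (mul_le_mul_of_nonneg_left (ENNReal.toReal_mono hfin hle) (by positivity))
    have hsmall : 3 * M * (D n ω).toReal ≤ ε₀ := by
      have := ENNReal.toReal_le_of_le_ofReal (by positivity) hn
      rw [le_div_iff₀ (by positivity)] at this
      linarith
    obtain ⟨v', hv', hvv⟩ := hstab (sampleMean (x n ω)) (3 * M * (D n ω).toReal)
      (mul_nonneg (by positivity) ENNReal.toReal_nonneg) hsmall (isAffineOn_sampleMean _ _ _)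
      (fun j => isAffineOn_sampleMean _ _ _) (hdev φ₀ hi₀ hle₀)
      (fun j => hdev (φ j) (hi j) (hlej j))
    refine ⟨v', hv', ?_⟩
    rw [← ENNReal.ofReal_toReal hfin, ← ENNReal.ofReal_mul (by positivity)]
    exact ENNReal.ofReal_le_ofReal (by linarith)
  have hval : val = (v : EReal) := hv
  refine ⟨?_, ?_, ?_, ?_⟩
  · filter_upwards [hmemI, hne a, hne b, hne c, ae_injective_sample hX_law hX_indep]
      with ω h1 h2 h3 h4 h5 n _
    have himg : evalAt a b s (x n ω) '' C = discreteShape a b c M g (x n ω) s :=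
      evalAt_image_ratioClass hab hM (h5.comp Fin.val_injective)
        (fun i => ⟨lt_of_le_of_ne (h1 i).1 (h2 i).symm, lt_of_le_of_ne (h1 i).2 (h3 i)⟩)
        (fun i => h4 i) hgpos s
    exact ⟨himg, evalAt_image_feasible φ μ himg, value_eq_lpValue φ₀ φ μ himg⟩
  · rw [hval]
    exact ⟨EReal.coe_ne_bot v, EReal.coe_ne_top v⟩
  · rw [hval]
    exact tendstoOuterAS_of_bound (by positivity) hDm hbound hlim
  · rw [hval]
    exact isBigOOneOuter_of_bound (by positivity) (by positivity) hDm hbound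
      (add_nonneg (he0 _) (Finset.sum_nonneg fun j _ => he0 _)) hE
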